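/- Let $m=(m_k)_{k\ge 0}$ be a bounded sequence of integers $m_k\ge 2$, put $M_0=1$, $M_{k+1}=m_kM_k$, and let $G_m=\prod_{k\ge0}\mathbb{Z}/m_k\mathbb{Z}$ be the corresponding Vilenkin group, with coordinates $x_k\in\{0,\dots,m_k-1\}$ and normalised Haar measure $\mu$; $\|\cdot\|_p$ is the norm of $L^p(G_m)=L^p(G_m,\mu)$ (complex-valued functions). For $n=\sum_k n_kM_k$ with $0\le n_k<m_k$ let $\psi_n(x)=\prod_k \exp(2\pi i\,n_kx_k/m_k)$, and for $f\in L^1(G_m)$ let $\widehat f(k)=\int_{G_m} f\,\overline{\psi_k}\,d\mu$ and $S_nf=\sum_{k=0}^{n-1}\widehat f(k)\psi_k$ (with $S_0f=0$). For a sequence $(q_k)_{k\ge0}$ put $Q_n=\sum_{k=0}^{n-1}q_k$ and $T_nf=\frac1{Q_n}\sum_{k=0}^{n-1}q_kS_kf$. With $|x|=\sum_{k\ge0}x_k/M_{k+1}$ let $\omega_p(\delta,f)=\sup_{|t|<\delta}\|f(\cdot-t)-f\|_p$, and let $\mathrm{Lip}(\alpha,p)$ be the set of $f\in L^p(G_m)$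 with $\omega_p(\delta,f)=O(\delta^\alpha)$ as $\delta\to0^+$. Let $(q_k)_{k\ge0}$ be non-negative and non-increasing with $q_k\asymp k^{-\beta}$ as $k\to\infty$ for some $0<\beta\le1$. If $f\in\mathrm{Lip}(\alpha,p)$ for some $\alpha>0$ and $1\le p<\infty$, then, as $n\to\infty$, $$\|T_nf-f\|_p=\begin{cases}O(n^{-\alpha}) & \text{if }\alpha+\beta<1,\\ O(n^{-(1-\beta)}\log n+n^{-\alpha}) & \text{if }\alpha+\beta=1,\\ O(n^{-(1-\beta)}) & \text{if }\alpha+\beta>1,\ \beta<1,\\ O((\log n)^{-1}) & \text{if }\beta=1.\end{cases}$$ -/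

import Mathlib

open MeasureTheory Filter Topology
open scoped ENNReal

namespace Vilenkin

/-- The Vilenkin group `G_m`: the complete direct product of the cyclic groups `ℤ / m_k`, with
coordinatewise addition and the product topology and `σ`-algebra. -/
abbrev G (m : ℕ → ℕ) : Type := ∀ k : ℕ, ZMod (m k)

/-- The normalised Haar measure: the direct product of the uniform probability measures on the
groups `ℤ / m_k`. -/
noncomputable def μ (m : ℕ → ℕ) [∀ k, NeZero (m k)] : Measure (G m) :=
  Measure.infinitePi fun k => (PMF.uniformOfFintype (ZMod (m k))).toMeasure

/-- The generalised powers `M_0 = 1`, `M_{k+1} = m_k M_k`. -/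
def M (m : ℕ → ℕ) : ℕ → ℕ
  | 0 => 1
  | k + 1 => m k * M m k

/-- The `k`-th digit of `n` in the number system generated by `m`. -/
def digit (m : ℕ → ℕ) (n k : ℕ) : ℕ := n / M m k % m k

/-- The generalised Rademacher functions `r_k(x) = exp(2πi x_k / m_k)`, where the coordinate `x_k`
is represented in `{0, …, m_k - 1}`. -/
noncomputable def rademacher (m : ℕ → ℕ) (k : ℕ) (x : G m) : ℂ :=
  Complex.exp (2 * Real.pi * Complex.I * ((x k).val : ℂ) / (m k : ℂ))

/-- The Vilenkin functions `ψ_n = ∏_k r_k ^ n_k`. When all `m_k ≥ 2`, the digits `n_k` with `n ≤ k`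
vanish (see `digit_eq_zero`), so this is the full product over all `k`. -/
noncomputable def ψ (m : ℕ → ℕ) (n : ℕ) (x : G m) : ℂ :=
  ∏ k ∈ Finset.range n, rademacher m k x ^ digit m n k

theorem lt_M {m : ℕ → ℕ} (hm : ∀ k, 2 ≤ m k) (k : ℕ) : k < M m k := by
  induction k with
  | zero => simp [M]
  | succ k ih =>
    have h := Nat.mul_le_mul (hm k) (Nat.succ_le_of_lt ih)
    simp only [M]
    omega

theorem digit_eq_zero {m : ℕ → ℕ} (hm : ∀ k, 2 ≤ m k) {n k : ℕ} (h : n ≤ k) :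
    digit m n k = 0 := by
  have : n / M m k = 0 := Nat.div_eq_of_lt (lt_of_le_of_lt h (lt_M hm k))
  simp [digit, this]

section
variable (m : ℕ → ℕ) [∀ k, NeZero (m k)]

/-- The Vilenkin-Fourier coefficients of `f`. -/
noncomputable def coeff (f : G m → ℂ) (k : ℕ) : ℂ :=
  ∫ x, f x * (starRingEnd ℂ) (ψ m k x) ∂(μ m)

/-- The partial sums `S_n f` of the Vilenkin-Fourier series (with `S_0 f = 0`). -/
noncomputable def S (f : G m → ℂ) (n : ℕ) (x : G m) : ℂ :=
  ∑ k ∈ Finset.range n, coeff m f k * ψ m k x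

/-- The `T` means `T_n f = (1 / Q_n) ∑_{k < n} q_k S_k f`, where `Q_n = ∑_{k < n} q_k`. -/
noncomputable def T (q : ℕ → ℝ) (f : G m → ℂ) (n : ℕ) (x : G m) : ℂ :=
  ((∑ k ∈ Finset.range n, q k : ℝ) : ℂ)⁻¹ * ∑ k ∈ Finset.range n, (q k : ℂ) * S m f k x

/-- The size `|x| = ∑_k x_k / M_{k+1}` of an element of the Vilenkin group. -/
noncomputable def size (x : G m) : ℝ := ∑' k, ((x k).val : ℝ) / (M m (k + 1) : ℝ)

/-- The `L^p` modulus of continuity `ω_p(δ, f) = sup_{|t| < δ} ‖f(· - t) - f‖_p`. -/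
noncomputable def modulus (p : ℝ≥0∞) (δ : ℝ) (f : G m → ℂ) : ℝ≥0∞ :=
  ⨆ (t : G m) (_ : size m t < δ), eLpNorm (fun x => f (x - t) - f x) p (μ m)

/-- `f ∈ Lip(α, p)`: `f ∈ L^p` and `ω_p(δ, f) = O(δ^α)` as `δ → 0+`. -/
def Lip (α : ℝ) (p : ℝ≥0∞) (f : G m → ℂ) : Prop :=
  MemLp f p (μ m) ∧
    ∃ C : ℝ, ∀ᶠ δ in 𝓝[>] (0 : ℝ), modulus m p δ f ≤ ENNReal.ofReal (C * δ ^ α)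

end

end Vilenkin

/-!
A block sum of `S_k f - f` over `M_j ≤ k < l ≤ M_{j+1}` does not change when `f` is replaced by
`f - S_{M_j} f`. It is then a convolution with a difference of Fejér-type kernels, whose `L¹` norms
are `O(M_j)` because `m` is bounded, so its `L^p` norm is `O(M_j ω_p(2 / M_j, f)) = O(M_j^{1 - α})`.
Since `q` is non-negative and non-increasing, Abel summation lets the weight `q_{M_j}` be pulled out
of each block, and `‖Q_n (T_n f - f)‖_p` is at most a constant times `1 + ∑_j q_{M_j} M_j^{1 - α}`,
which is of the order of the lacunary sum `∑_j M_j^{1 - α - β}` over `M_j ≤ n`. The four cases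
compare this sum, according to the sign of its exponent, with `Q_n`, which is at least of order
`n^{1 - β}`, and of order `log n` when `β = 1`.
-/

section LpSuperposition

variable {X Y : Type*} [MeasurableSpace X] [MeasurableSpace Y] {μ : Measure X} {ν : Measure Y}
  {p : ℝ≥0∞}

theorem lintegral_rpow_le_measure_univ_rpow_mul {g : Y → ℝ≥0∞} (hg : AEMeasurable g ν) {r : ℝ}
    (hr : 1 ≤ r) :
    (∫⁻ y, g y ∂ν) ^ r ≤ ν Set.univ ^ (r - 1) * ∫⁻ y, g y ^ r ∂ν := by
  rcases hr.eq_or_lt with rfl | hr1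
  · simp
  have hr0 : 0 < r := zero_lt_one.trans hr1
  have hholder := ENNReal.lintegral_mul_le_Lp_mul_Lq ν (Real.HolderConjugate.conjExponent hr1) hg
    (aemeasurable_const (b := (1 : ℝ≥0∞)))
  simp only [Pi.mul_apply, mul_one, ENNReal.one_rpow, lintegral_const, one_mul] at hholder
  calc (∫⁻ y, g y ∂ν) ^ r
      ≤ ((∫⁻ y, g y ^ r ∂ν) ^ (1 / r) * ν Set.univ ^ (1 / r.conjExponent)) ^ r := by gcongr
    _ = ν Set.univ ^ (r - 1) * ∫⁻ y, g y ^ r ∂ν := by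
        rw [ENNReal.mul_rpow_of_nonneg _ _ hr0.le, ← ENNReal.rpow_mul, ← ENNReal.rpow_mul,
          one_div_mul_cancel hr0.ne', ENNReal.rpow_one, mul_comm, Real.conjExponent]
        congr 2
        field_simp

theorem ae_lintegral_le_of_ae_ae_le [SFinite μ] [SFinite ν] {g : X × Y → ℝ≥0∞}
    (hg : AEMeasurable g (μ.prod ν)) {B : ℝ≥0∞} (hB : ∀ᵐ y ∂ν, ∀ᵐ x ∂μ, g (x, y) ≤ B) :
    ∀ᵐ x ∂μ, ∫⁻ y, g (x, y) ∂ν ≤ B * ν Set.univ := by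
  have hswap : ∀ᵐ y ∂ν, ∀ᵐ x ∂μ, g (x, y) = hg.mk g (x, y) :=
    Measure.ae_ae_of_ae_prod (Measure.measurePreserving_swap.quasiMeasurePreserving.ae hg.ae_eq_mk)
  have hmk : ∀ᵐ x ∂μ, ∀ᵐ y ∂ν, hg.mk g (x, y) ≤ B := by
    refine (Measure.ae_ae_comm (p := fun x y => hg.mk g (x, y) ≤ B)
      (measurableSet_le hg.measurable_mk measurable_const)).2 ?_
    filter_upwards [hB, hswap] with y hyB hy
    filter_upwards [hyB, hy] with x hxB hx
    exact hx ▸ hxB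
  filter_upwards [Measure.ae_ae_of_ae_prod hg.ae_eq_mk, hmk] with x hx hxB
  rw [← lintegral_const]
  refine lintegral_mono_ae ?_
  filter_upwards [hx, hxB] with y hy hyB
  exact hy.trans_le hyB

theorem eLpNorm_lintegral_le_mul_measure_univ [SFinite μ] [IsFiniteMeasure ν] (hp : 1 ≤ p)
    {g : X × Y → ℝ≥0∞} (hg : AEMeasurable g (μ.prod ν)) {B : ℝ≥0∞}
    (hB : ∀ᵐ y ∂ν, eLpNorm (fun x => g (x, y)) p μ ≤ B) :
    eLpNorm (fun x => ∫⁻ y, g (x, y) ∂ν) p μ ≤ B * ν Set.univ := by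
  rcases eq_or_ne p ∞ with rfl | hp_top
  · simp only [eLpNorm_exponent_top] at hB ⊢
    refine essSup_le_of_ae_le _ (ae_lintegral_le_of_ae_ae_le hg ?_)
    filter_upwards [hB] with y hy
    filter_upwards [enorm_ae_le_eLpNormEssSup (fun x => g (x, y)) μ] with x hx
    exact hx.trans hy
  have hp0 : p ≠ 0 := (one_pos.trans_le hp).ne'
  have hr1 : 1 ≤ p.toReal := ENNReal.toReal_mono hp_top hp
  have hr0 : 0 < p.toReal := zero_lt_one.trans_le hr1
  simp only [eLpNorm_eq_lintegral_rpow_enorm_toReal hp0 hp_top, one_div, enorm_eq_self,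
    ENNReal.rpow_inv_le_iff hr0] at hB ⊢
  set r := p.toReal
  -- Jensen bounds the `p`-th power by an iterated integral, whose order can be exchanged.
  have hjensen : ∀ᵐ x ∂μ, (∫⁻ y, g (x, y) ∂ν) ^ r ≤
      ν Set.univ ^ (r - 1) * ∫⁻ y, g (x, y) ^ r ∂ν := by
    filter_upwards [hg.aestronglyMeasurable.prodMk_left] with x hx
    exact lintegral_rpow_le_measure_univ_rpow_mul hx.aemeasurable hr1
  calc ∫⁻ x, (∫⁻ y, g (x, y) ∂ν) ^ r ∂μ
      ≤ ν Set.univ ^ (r - 1) * ∫⁻ x, ∫⁻ y, g (x, y) ^ r ∂ν ∂μ := by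
        rw [← lintegral_const_mul' _ _
          (ENNReal.rpow_ne_top_of_nonneg (sub_nonneg.2 hr1) (measure_ne_top ν _))]
        exact lintegral_mono_ae hjensen
    _ = ν Set.univ ^ (r - 1) * ∫⁻ y, ∫⁻ x, g (x, y) ^ r ∂μ ∂ν := by
        rw [lintegral_lintegral_swap (hg.pow_const r)]
    _ ≤ ν Set.univ ^ (r - 1) * (B ^ r * ν Set.univ) := by
        rw [← lintegral_const]
        gcongr 1
        exact lintegral_mono_ae hB
    _ = (B * ν Set.univ) ^ r := by
        rw [ENNReal.mul_rpow_of_nonneg _ _ hr0.le, mul_left_comm]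
        congr 1
        nth_rw 2 [← ENNReal.rpow_one (ν Set.univ)]
        rw [← ENNReal.rpow_add_of_nonneg _ _ (sub_nonneg.2 hr1) zero_le_one, sub_add_cancel]

theorem eLpNorm_integral_smul_le [SFinite μ] [SFinite ν] {𝕜 E : Type*} [NormedField 𝕜]
    [NormedAddCommGroup E] [NormedSpace ℝ E] [NormedSpace 𝕜 E] (hp : 1 ≤ p) {h : X × Y → E}
    (hh : AEStronglyMeasurable h (μ.prod ν)) {K : Y → 𝕜} (hK : Integrable K ν) {B : ℝ≥0∞}
    (hB : ∀ y, K y ≠ 0 → eLpNorm (fun x => h (x, y)) p μ ≤ B) :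
    eLpNorm (fun x => ∫ y, K y • h (x, y) ∂ν) p μ ≤ B * ∫⁻ y, ‖K y‖ₑ ∂ν := by
  set ρ : Measure Y := ν.withDensity fun y => ‖K y‖ₑ
  have hKm : AEMeasurable (fun y => ‖K y‖ₑ) ν := hK.1.enorm
  have hρ_univ : ρ Set.univ = ∫⁻ y, ‖K y‖ₑ ∂ν := by
    simp only [ρ, withDensity_apply _ MeasurableSet.univ, Measure.restrict_univ]
  have : IsFiniteMeasure ρ := ⟨hρ_univ ▸ hK.hasFiniteIntegral⟩
  have hhρ : AEStronglyMeasurable h (μ.prod ρ) := hh.mono_ac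
    (Measure.AbsolutelyContinuous.rfl.prod (withDensity_absolutelyContinuous _ _))
  have hbound : ∀ᵐ x ∂μ, ‖∫ y, K y • h (x, y) ∂ν‖ₑ ≤ ‖∫⁻ y, ‖h (x, y)‖ₑ ∂ρ‖ₑ := by
    filter_upwards [hh.prodMk_left] with x hx
    rw [enorm_eq_self, lintegral_withDensity_eq_lintegral_mul₀ hKm hx.enorm]
    refine (enorm_integral_le_lintegral_enorm _).trans_eq (lintegral_congr fun y => ?_)
    rw [enorm_smul, Pi.mul_apply]
  have hK0 : ∀ᵐ y ∂ρ, K y ≠ 0 :=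
    (ae_withDensity_iff' hKm).2 (Eventually.of_forall fun y hy => by simpa using hy)
  rw [← hρ_univ]
  refine (eLpNorm_mono_enorm_ae hbound).trans
    (eLpNorm_lintegral_le_mul_measure_univ hp hhρ.enorm ?_)
  filter_upwards [hK0] with y hy
  simpa only [eLpNorm_enorm] using hB y hy

end LpSuperposition

theorem integral_eq_zero_of_add_left_eq_smul {A 𝕜 E : Type*} [AddGroup A] [MeasurableSpace A]
    [MeasurableAdd A] {μ : Measure A} [μ.IsAddLeftInvariant] [NormedField 𝕜]
    [NormedAddCommGroup E] [NormedSpace ℝ E] [NormedSpace 𝕜 E] [SMulCommClass ℝ 𝕜 E]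
    {φ : A → E} {a : A} {c : 𝕜} (hc : c ≠ 1) (h : ∀ x, φ (a + x) = c • φ x) :
    ∫ x, φ x ∂μ = 0 := by
  have hfix : c • ∫ x, φ x ∂μ = ∫ x, φ x ∂μ := by
    rw [← integral_smul, ← integral_add_left_eq_self φ a]
    simp only [h]
  by_contra hne
  exact hc (smul_left_injective 𝕜 hne (hfix.trans (one_smul 𝕜 _).symm))

theorem map_uniformOfFintype_equiv {X Y : Type*} [Fintype X] [Nonempty X] [Fintype Y] [Nonempty Y]
    (e : X ≃ Y) : (PMF.uniformOfFintype X).map e = PMF.uniformOfFintype Y := by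
  ext y
  rw [PMF.map_apply, tsum_eq_single (e.symm y) fun x hx =>
    if_neg fun h => hx (e.eq_symm_apply.2 h.symm)]
  simp [Fintype.card_congr e]

namespace Vilenkin

section Haar

variable (m : ℕ → ℕ) [∀ k, NeZero (m k)]

instance isProbabilityMeasure_μ : IsProbabilityMeasure (μ m) := by
  unfold μ; infer_instance

theorem map_μ (e : ∀ k, ZMod (m k) ≃ ZMod (m k)) :
    (μ m).map (fun x k => e k (x k)) = μ m := by
  unfold μ
  rw [Measure.infinitePi_map_pi _ fun k => measurable_of_countable _]
  congr 1
  funext k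
  rw [PMF.toMeasure_map _ _ (measurable_of_countable _), map_uniformOfFintype_equiv]

instance isAddLeftInvariant_μ : (μ m).IsAddLeftInvariant :=
  ⟨fun g => map_μ m fun k => Equiv.addLeft (g k)⟩

instance isNegInvariant_μ : (μ m).IsNegInvariant :=
  ⟨map_μ m fun k => Equiv.neg (ZMod (m k))⟩

end Haar

section Digits

variable {m : ℕ → ℕ}

theorem M_dvd_M {i j : ℕ} (h : i ≤ j) : M m i ∣ M m j := by
  induction h with
  | refl => exact dvd_rfl
  | step _ ih => exact ih.trans (Dvd.intro_left _ rfl)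

theorem M_pos [∀ k, NeZero (m k)] (k : ℕ) : 0 < M m k := by
  induction k with
  | zero => exact one_pos
  | succ k ih => exact Nat.mul_pos (NeZero.pos (m k)) ih

theorem M_mono [∀ k, NeZero (m k)] : Monotone (M m) :=
  fun _ j h => Nat.le_of_dvd (M_pos j) (M_dvd_M h)

theorem mod_M_succ (n j : ℕ) : n % M m (j + 1) = n % M m j + M m j * digit m n j := by
  rw [M, mul_comm, Nat.mod_mul, digit]

theorem digit_eq_mod_div (n k : ℕ) : digit m n k = n % M m (k + 1) / M m k := by
  rw [digit, M, mul_comm, Nat.mod_mul_right_div_self]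

theorem digit_eq_zero_of_lt {n k : ℕ} (h : n < M m k) : digit m n k = 0 := by
  rw [digit, Nat.div_eq_of_lt h, Nat.zero_mod]

theorem digit_mul_add_self {i j s : ℕ} (hi : i < M m j) (hs : s < m j) :
    digit m (s * M m j + i) j = s := by
  rw [digit, mul_comm, Nat.mul_add_div (i.zero_le.trans_lt hi), Nat.div_eq_of_lt hi, add_zero,
    Nat.mod_eq_of_lt hs]

theorem digit_mul_add_of_lt {i j s k : ℕ} (hk : k < j) :
    digit m (s * M m j + i) k = digit m i k := by
  obtain ⟨c, hc⟩ := M_dvd_M (m := m) (Nat.succ_le_of_lt hk)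
  rw [digit_eq_mod_div, digit_eq_mod_div, hc, mul_left_comm, Nat.mul_add_mod]

theorem digit_injective (hm : ∀ k, 2 ≤ m k) : Function.Injective (digit m) := by
  intro a b hab
  have hmod : ∀ j, a % M m j = b % M m j := fun j => by
    induction j with
    | zero => simp only [M, Nat.mod_one]
    | succ j ih => rw [mod_M_succ, mod_M_succ, ih, hab]
  have ha := (le_max_left a b).trans_lt (lt_M hm (max a b))
  have hb := (le_max_right a b).trans_lt (lt_M hm (max a b))
  simpa only [Nat.mod_eq_of_lt ha, Nat.mod_eq_of_lt hb] using hmod (max a b)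

end Digits

section Characters

variable {m : ℕ → ℕ}

theorem ψ_zero (x : G m) : ψ m 0 x = 1 := by simp [ψ]

variable [∀ k, NeZero (m k)]

theorem rademacher_eq (k : ℕ) (x : G m) : rademacher m k x = ZMod.stdAddChar (x k) := by
  rw [rademacher, ZMod.stdAddChar_apply, ZMod.toCircle_apply]

theorem norm_rademacher (k : ℕ) (x : G m) : ‖rademacher m k x‖ = 1 := by
  rw [rademacher_eq, ZMod.stdAddChar_apply, Circle.norm_coe]

theorem measurable_rademacher (k : ℕ) : Measurable (rademacher m k) := by
  rw [funext (rademacher_eq k)]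
  exact (measurable_of_countable (ZMod.stdAddChar (N := m k))).comp (measurable_pi_apply k)

theorem sum_rademacher_pow (k : ℕ) (x : G m) :
    ∑ s ∈ Finset.range (m k), rademacher m k x ^ s = if x k = 0 then (m k : ℂ) else 0 := by
  rw [rademacher_eq]
  split_ifs with h
  · simp [h]
  · have hne : ZMod.stdAddChar (x k) ≠ 1 := fun h1 =>
      h (ZMod.injective_stdAddChar (h1.trans (AddChar.map_zero_eq_one _).symm))
    rw [geom_sum_eq hne, ← AddChar.map_nsmul_eq_pow]
    simp

theorem measurable_ψ (n : ℕ) : Measurable (ψ m n) :=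
  Finset.measurable_prod _ fun k _ => (measurable_rademacher k).pow_const _

theorem norm_ψ (n : ℕ) (x : G m) : ‖ψ m n x‖ = 1 := by
  simp [ψ, norm_prod, norm_rademacher]

theorem ψ_ne_zero (n : ℕ) (x : G m) : ψ m n x ≠ 0 :=
  norm_ne_zero_iff.1 ((norm_ψ n x).trans_ne one_ne_zero)

theorem conj_ψ (n : ℕ) (x : G m) : (starRingEnd ℂ) (ψ m n x) = (ψ m n x)⁻¹ :=
  (Complex.inv_eq_conj (norm_ψ n x)).symm

theorem ψ_add (n : ℕ) (x y : G m) : ψ m n (x + y) = ψ m n x * ψ m n y := by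
  simp_rw [ψ, ← Finset.prod_mul_distrib, ← mul_pow]
  simp [rademacher_eq, AddChar.map_add_eq_mul]

theorem ψ_mul_conj_sub (n : ℕ) (x t : G m) :
    ψ m n x * (starRingEnd ℂ) (ψ m n (x - t)) = ψ m n t := by
  rw [conj_ψ, mul_inv_eq_iff_eq_mul₀ (ψ_ne_zero n _), ← ψ_add, add_sub_cancel]

theorem integrable_ψ (n : ℕ) : Integrable (ψ m n) (μ m) :=
  Integrable.of_bound (measurable_ψ n).aestronglyMeasurable 1
    (Eventually.of_forall fun x => (norm_ψ n x).le)

theorem ψ_eq_prod (hm : ∀ k, 2 ≤ m k) {n j : ℕ} (h : n < M m j) (x : G m) :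
    ψ m n x = ∏ k ∈ Finset.range j, rademacher m k x ^ digit m n k := by
  have hn : ∀ k ∉ Finset.range n, rademacher m k x ^ digit m n k = 1 := fun k hk => by
    rw [digit_eq_zero hm (by simpa using hk), pow_zero]
  have hj : ∀ k ∉ Finset.range j, rademacher m k x ^ digit m n k = 1 := fun k hk => by
    rw [digit_eq_zero_of_lt (h.trans_le (M_mono (by simpa using hk))), pow_zero]
  rw [ψ]
  rcases le_total n j with hnj | hnj
  · exact Finset.prod_subset (Finset.range_mono hnj) fun k _ => hn k
  · exact (Finset.prod_subset (Finset.range_mono hnj) fun k _ => hj k).symm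

theorem ψ_mul_add (hm : ∀ k, 2 ≤ m k) {i j s : ℕ} (hi : i < M m j) (hs : s < m j) (x : G m) :
    ψ m (s * M m j + i) x = rademacher m j x ^ s * ψ m i x := by
  have hlt : s * M m j + i < M m (j + 1) := by
    calc s * M m j + i < s * M m j + M m j := by gcongr
      _ = (s + 1) * M m j := (Nat.succ_mul _ _).symm
      _ ≤ M m (j + 1) := Nat.mul_le_mul_right _ hs
  rw [ψ_eq_prod hm hlt, ψ_eq_prod hm hi, Finset.prod_range_succ, digit_mul_add_self hi hs, mul_comm]
  congr 1
  exact Finset.prod_congr rfl fun k hk => by rw [digit_mul_add_of_lt (Finset.mem_range.1 hk)]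

theorem ψ_single (hm : ∀ k, 2 ≤ m k) (n j : ℕ) (a : ZMod (m j)) :
    ψ m n (Pi.single j a) = ZMod.stdAddChar ((digit m n j : ZMod (m j)) * a) := by
  obtain ⟨J, hJn, hJj⟩ : ∃ J, n < M m J ∧ j < J :=
    ⟨max n j + 1, (lt_M hm n).trans_le (M_mono (by omega)), by omega⟩
  rw [ψ_eq_prod hm hJn, Finset.prod_eq_single j]
  · rw [rademacher_eq, Pi.single_eq_same, ← AddChar.map_nsmul_eq_pow, nsmul_eq_mul]
  · intro k _ hk
    simp [rademacher_eq, Pi.single_eq_of_ne hk]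
  · simp [hJj]

theorem integral_ψ_mul_conj (hm : ∀ k, 2 ≤ m k) (a b : ℕ) :
    ∫ x, ψ m a x * (starRingEnd ℂ) (ψ m b x) ∂μ m = if a = b then 1 else 0 := by
  simp only [conj_ψ, ← div_eq_mul_inv]
  split_ifs with hab
  · subst hab
    simp [div_self (ψ_ne_zero _ _)]
  obtain ⟨j, hj⟩ := Function.ne_iff.1 ((digit_injective hm).ne hab)
  have hne : ψ m a (Pi.single j 1) ≠ ψ m b (Pi.single j 1) := by
    rw [ψ_single hm, ψ_single hm, mul_one, mul_one, ZMod.injective_stdAddChar.ne_iff, Ne,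
      ZMod.natCast_eq_natCast_iff']
    simpa only [digit, Nat.mod_mod] using hj
  refine integral_eq_zero_of_add_left_eq_smul (a := Pi.single j 1)
    (c := ψ m a (Pi.single j 1) / ψ m b (Pi.single j 1))
    ((div_eq_one_iff_eq (ψ_ne_zero _ _)).not.2 hne) fun x => ?_
  rw [ψ_add, ψ_add, mul_div_mul_comm, smul_eq_mul]

end Characters

section Kernels

variable {m : ℕ → ℕ}

/-- The Dirichlet kernel `D_k = ∑_{i < k} ψ_i`, the convolution kernel of `S_k`. -/
noncomputable def dirichlet (m : ℕ → ℕ) (k : ℕ) (x : G m) : ℂ := ∑ i ∈ Finset.range k, ψ m i x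

/-- The Fejér kernel `∑_{k < l} D_k`, without the normalising factor `1 / l`, which governs sums
of consecutive partial sums `S_k`. -/
noncomputable def fejer (m : ℕ → ℕ) (l : ℕ) (x : G m) : ℂ := ∑ k ∈ Finset.range l, dirichlet m k x

theorem fejer_of_le_one {l : ℕ} (hl : l ≤ 1) (x : G m) : fejer m l x = 0 := by
  interval_cases l <;> simp [fejer, dirichlet]

variable [∀ k, NeZero (m k)]

theorem measurable_dirichlet (k : ℕ) : Measurable (dirichlet m k) :=
  Finset.measurable_sum _ fun i _ => measurable_ψ i

theorem measurable_fejer (l : ℕ) : Measurable (fejer m l) :=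
  Finset.measurable_sum _ fun k _ => measurable_dirichlet k

theorem integrable_dirichlet (k : ℕ) : Integrable (dirichlet m k) (μ m) :=
  integrable_finsetSum _ fun i _ => integrable_ψ i

theorem integrable_fejer (l : ℕ) : Integrable (fejer m l) (μ m) :=
  integrable_finsetSum _ fun k _ => integrable_dirichlet k

theorem integral_dirichlet (hm : ∀ k, 2 ≤ m k) {k : ℕ} (hk : 0 < k) :
    ∫ x, dirichlet m k x ∂μ m = 1 := by
  have hψ : ∀ i, ∫ x, ψ m i x ∂μ m = if i = 0 then 1 else 0 := fun i => by
    simpa [ψ_zero] using integral_ψ_mul_conj hm i 0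
  simp only [dirichlet, integral_finsetSum _ fun i _ => integrable_ψ i, hψ, Finset.sum_ite_eq',
    Finset.mem_range, hk, if_true]

theorem dirichlet_mul_add (hm : ∀ k, 2 ≤ m k) {i j s : ℕ} (hi : i ≤ M m j) (hs : s < m j)
    (x : G m) :
    dirichlet m (s * M m j + i) x =
      dirichlet m (s * M m j) x + rademacher m j x ^ s * dirichlet m i x := by
  rw [dirichlet, Finset.sum_range_add, ← dirichlet]
  congr 1
  rw [dirichlet, Finset.mul_sum]
  exact Finset.sum_congr rfl fun k hk =>
    ψ_mul_add hm ((Finset.mem_range.1 hk).trans_le hi) hs x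

theorem dirichlet_mul (hm : ∀ k, 2 ≤ m k) {j s : ℕ} (hs : s ≤ m j) (x : G m) :
    dirichlet m (s * M m j) x =
      (∑ t ∈ Finset.range s, rademacher m j x ^ t) * dirichlet m (M m j) x := by
  induction s with
  | zero => simp [dirichlet]
  | succ s ih =>
    rw [Nat.succ_mul, dirichlet_mul_add hm le_rfl hs, ih (Nat.le_of_succ_le hs),
      Finset.sum_range_succ, add_mul]

theorem dirichlet_M (hm : ∀ k, 2 ≤ m k) (j : ℕ) (x : G m) :
    dirichlet m (M m j) x = if ∀ k < j, x k = 0 then (M m j : ℂ) else 0 := by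
  induction j with
  | zero => simp [dirichlet, M, ψ_zero]
  | succ j ih =>
    rw [M, dirichlet_mul hm le_rfl, sum_rademacher_pow, ih]
    simp only [Nat.forall_lt_succ_right]
    by_cases h1 : x j = 0 <;> by_cases h2 : ∀ k < j, x k = 0 <;> simp [h1, h2]

theorem lintegral_enorm_dirichlet_M (hm : ∀ k, 2 ≤ m k) (j : ℕ) :
    ∫⁻ x, ‖dirichlet m (M m j) x‖ₑ ∂μ m = 1 := by
  have hnonneg : ∀ x, ((‖dirichlet m (M m j) x‖ : ℝ) : ℂ) = dirichlet m (M m j) x := fun x => by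
    rw [dirichlet_M hm]; split_ifs <;> simp
  have hreal : ∫ x, ‖dirichlet m (M m j) x‖ ∂μ m = 1 := by
    rw [← Complex.ofReal_inj, ← integral_complex_ofReal]
    simp only [hnonneg, integral_dirichlet hm (M_pos j), Complex.ofReal_one]
  rw [← ofReal_integral_norm_eq_lintegral_enorm (integrable_dirichlet _), hreal,
    ENNReal.ofReal_one]

theorem fejer_mul_add (hm : ∀ k, 2 ≤ m k) {r j s : ℕ} (hr : r ≤ M m j) (hs : s < m j)
    (x : G m) :
    fejer m (s * M m j + r) x = fejer m (s * M m j) x +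
      (r * dirichlet m (s * M m j) x + rademacher m j x ^ s * fejer m r x) := by
  rw [fejer, Finset.sum_range_add, ← fejer]
  congr 1
  rw [Finset.sum_congr rfl fun k hk =>
    dirichlet_mul_add hm ((Finset.mem_range.1 hk).le.trans hr) hs x]
  simp [Finset.sum_add_distrib, ← Finset.mul_sum, fejer]

theorem fejer_mul (hm : ∀ k, 2 ≤ m k) {j s : ℕ} (hs : s ≤ m j) (x : G m) :
    fejer m (s * M m j) x =
      M m j * ∑ u ∈ Finset.range s, dirichlet m (u * M m j) x +
        (∑ u ∈ Finset.range s, rademacher m j x ^ u) * fejer m (M m j) x := by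
  induction s with
  | zero => simp [fejer]
  | succ s ih =>
    rw [Nat.succ_mul, fejer_mul_add hm le_rfl hs, ih (Nat.le_of_succ_le hs), Finset.sum_range_succ,
      Finset.sum_range_succ _ s]
    ring

theorem fejer_M_add_single (hm : ∀ k, 2 ≤ m k) {j : ℕ} (a : ZMod (m j)) (x : G m) :
    fejer m (M m j) (Pi.single j a + x) = fejer m (M m j) x := by
  refine Finset.sum_congr rfl fun k hk => Finset.sum_congr rfl fun i hi => ?_
  have hi_lt : i < M m j := (Finset.mem_range.1 hi).trans (Finset.mem_range.1 hk)
  rw [ψ_add, ψ_single hm, digit_eq_zero_of_lt hi_lt, Nat.cast_zero, zero_mul,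
    AddChar.map_zero_eq_one, one_mul]

theorem enorm_sum_rademacher_pow_le (j s : ℕ) (x : G m) :
    ‖∑ t ∈ Finset.range s, rademacher m j x ^ t‖ₑ ≤ s := by
  refine (enorm_sum_le _ _).trans_eq ?_
  simp [← ofReal_norm, norm_rademacher]

theorem enorm_dirichlet_mul_le (hm : ∀ k, 2 ≤ m k) {j s : ℕ} (hs : s ≤ m j) (x : G m) :
    ‖dirichlet m (s * M m j) x‖ₑ ≤ s * ‖dirichlet m (M m j) x‖ₑ := by
  rw [dirichlet_mul hm hs, enorm_mul]
  gcongr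
  exact enorm_sum_rademacher_pow_le j s x

theorem enorm_fejer_mul_le (hm : ∀ k, 2 ≤ m k) {j s : ℕ} (hs : s ≤ m j) (x : G m) :
    ‖fejer m (s * M m j) x‖ₑ ≤ (M m j * s ^ 2 : ℕ) * ‖dirichlet m (M m j) x‖ₑ +
      ‖∑ u ∈ Finset.range s, rademacher m j x ^ u‖ₑ * ‖fejer m (M m j) x‖ₑ := by
  have hsum : ‖∑ u ∈ Finset.range s, dirichlet m (u * M m j) x‖ₑ ≤
      (s ^ 2 : ℕ) * ‖dirichlet m (M m j) x‖ₑ := by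
    calc _ ≤ ∑ u ∈ Finset.range s, ‖dirichlet m (u * M m j) x‖ₑ := enorm_sum_le _ _
      _ ≤ ∑ _u ∈ Finset.range s, (s : ℝ≥0∞) * ‖dirichlet m (M m j) x‖ₑ := by
          refine Finset.sum_le_sum fun u hu => ?_
          have hus : u ≤ s := (Finset.mem_range.1 hu).le
          exact (enorm_dirichlet_mul_le hm (hus.trans hs) x).trans (by gcongr)
      _ = _ := by
          rw [Finset.sum_const, Finset.card_range, nsmul_eq_mul, ← mul_assoc, sq, Nat.cast_mul]
  rw [fejer_mul hm hs]
  refine (enorm_add_le _ _).trans ?_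
  rw [enorm_mul, enorm_mul, Nat.cast_mul, mul_assoc]
  gcongr
  simp [← ofReal_norm]

theorem enorm_fejer_mul_add_le (hm : ∀ k, 2 ≤ m k) {r j s : ℕ} (hr : r ≤ M m j) (hs : s < m j)
    (x : G m) :
    ‖fejer m (s * M m j + r) x‖ₑ ≤ (M m j * s ^ 2 + r * s : ℕ) * ‖dirichlet m (M m j) x‖ₑ +
      s * ‖fejer m (M m j) x‖ₑ + ‖fejer m r x‖ₑ := by
  have hfull : ‖fejer m (s * M m j) x‖ₑ ≤ (M m j * s ^ 2 : ℕ) * ‖dirichlet m (M m j) x‖ₑ +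
      s * ‖fejer m (M m j) x‖ₑ :=
    (enorm_fejer_mul_le hm hs.le x).trans
      (by gcongr; exact enorm_sum_rademacher_pow_le j s x)
  have hmid : ‖(r : ℂ) * dirichlet m (s * M m j) x‖ₑ ≤
      (r * s : ℕ) * ‖dirichlet m (M m j) x‖ₑ := by
    rw [enorm_mul, Nat.cast_mul, mul_assoc]
    gcongr
    · simp [← ofReal_norm]
    · exact enorm_dirichlet_mul_le hm hs.le x
  have hrest : ‖rademacher m j x ^ s * fejer m r x‖ₑ = ‖fejer m r x‖ₑ := by
    rw [enorm_mul, enorm_pow, ← ofReal_norm, norm_rademacher, ENNReal.ofReal_one, one_pow, one_mul]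
  rw [fejer_mul_add hm hr hs]
  calc _ ≤ _ := (enorm_add_le _ _).trans
        (add_le_add hfull ((enorm_add_le _ _).trans (add_le_add hmid hrest.le)))
    _ = _ := by push_cast; ring

theorem mul_lintegral_coord_mul {j : ℕ} (w : ZMod (m j) → ℝ≥0∞) {φ : G m → ℝ≥0∞}
    (hφ : Measurable φ) (hinv : ∀ (a : ZMod (m j)) x, φ (Pi.single j a + x) = φ x) :
    m j * ∫⁻ x, w (x j) * φ x ∂μ m = (∑ a, w a) * ∫⁻ x, φ x ∂μ m := by
  have hw : ∀ a, Measurable fun x : G m => w (a + x j) := fun a =>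
    (measurable_of_countable fun y => w (a + y)).comp (measurable_pi_apply j)
  have hshift : ∀ a, ∫⁻ x, w (x j) * φ x ∂μ m = ∫⁻ x, w (a + x j) * φ x ∂μ m := fun a => by
    rw [← lintegral_add_left_eq_self _ (Pi.single j a)]
    simp only [hinv, Pi.add_apply, Pi.single_eq_same]
  have hsum : ∀ x : G m, ∑ a, w (a + x j) = ∑ a, w a := fun x =>
    Equiv.sum_comp (Equiv.addRight (x j)) w
  calc m j * ∫⁻ x, w (x j) * φ x ∂μ m
      = ∑ a, ∫⁻ x, w (a + x j) * φ x ∂μ m := by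
        simp [← hshift, ZMod.card]
    _ = ∫⁻ x, (∑ a, w (a + x j)) * φ x ∂μ m := by
        simp only [Finset.sum_mul]
        exact (lintegral_finsetSum _ fun a _ => (hw a).mul hφ).symm
    _ = (∑ a, w a) * ∫⁻ x, φ x ∂μ m := by
        simp only [hsum]
        rw [lintegral_const_mul _ hφ]

theorem lintegral_enorm_fejer_M_succ_le (hm : ∀ k, 2 ≤ m k) (j : ℕ) :
    ∫⁻ x, ‖fejer m (M m (j + 1)) x‖ₑ ∂μ m ≤
      (M m j * m j ^ 2 : ℕ) + ∫⁻ x, ‖fejer m (M m j) x‖ₑ ∂μ m := by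
  let w : ZMod (m j) → ℝ≥0∞ := fun a => if a = 0 then m j else 0
  have hw : ∀ x : G m, ‖∑ u ∈ Finset.range (m j), rademacher m j x ^ u‖ₑ = w (x j) := fun x => by
    rw [sum_rademacher_pow]
    split_ifs with h <;> simp [w, h, ← ofReal_norm]
  have hmean : ∫⁻ x, w (x j) * ‖fejer m (M m j) x‖ₑ ∂μ m = ∫⁻ x, ‖fejer m (M m j) x‖ₑ ∂μ m := by
    have h := mul_lintegral_coord_mul w (measurable_fejer (m := m) (M m j)).enorm
      fun a x => by rw [fejer_M_add_single hm]
    rw [Finset.sum_ite_eq' Finset.univ (0 : ZMod (m j)), if_pos (Finset.mem_univ _)] at h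
    exact (ENNReal.mul_right_inj (Nat.cast_ne_zero.2 (NeZero.ne (m j)))
      (ENNReal.natCast_ne_top _)).1 h
  calc ∫⁻ x, ‖fejer m (M m (j + 1)) x‖ₑ ∂μ m
      ≤ ∫⁻ x, (M m j * m j ^ 2 : ℕ) * ‖dirichlet m (M m j) x‖ₑ +
          w (x j) * ‖fejer m (M m j) x‖ₑ ∂μ m :=
        lintegral_mono fun x => hw x ▸ enorm_fejer_mul_le hm le_rfl x
    _ = _ := by
        rw [lintegral_add_left ((measurable_dirichlet _).enorm.const_mul _),
          lintegral_const_mul _ (measurable_dirichlet _).enorm, lintegral_enorm_dirichlet_M hm,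
          mul_one, hmean]

theorem lintegral_enorm_fejer_mul_add_le (hm : ∀ k, 2 ≤ m k) {r j s : ℕ} (hr : r ≤ M m j)
    (hs : s < m j) :
    ∫⁻ x, ‖fejer m (s * M m j + r) x‖ₑ ∂μ m ≤ (M m j * s ^ 2 + r * s : ℕ) +
      s * ∫⁻ x, ‖fejer m (M m j) x‖ₑ ∂μ m + ∫⁻ x, ‖fejer m r x‖ₑ ∂μ m := by
  refine (lintegral_mono fun x => enorm_fejer_mul_add_le hm hr hs x).trans_eq ?_
  have hD := (measurable_dirichlet (m := m) (M m j)).enorm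
  have hF := (measurable_fejer (m := m) (M m j)).enorm
  rw [lintegral_add_right _ (measurable_fejer r).enorm, lintegral_add_right _ (hF.const_mul _),
    lintegral_const_mul _ hD, lintegral_const_mul _ hF, lintegral_enorm_dirichlet_M hm, mul_one]

theorem lintegral_enorm_fejer_M_le (hm : ∀ k, 2 ≤ m k) {b : ℕ} (hb : ∀ k, m k ≤ b) (j : ℕ) :
    ∫⁻ x, ‖fejer m (M m j) x‖ₑ ∂μ m ≤ (2 * b * M m j : ℕ) := by
  induction j with
  | zero => simp [M, fejer_of_le_one]
  | succ j ih =>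
    refine (lintegral_enorm_fejer_M_succ_le hm j).trans ((add_le_add_right ih _).trans ?_)
    norm_cast
    have h2 := Nat.mul_le_mul_left (b * M m j) (hm j)
    have hb' := Nat.mul_le_mul_left (M m j * m j) (hb j)
    rw [M]
    linarith

theorem lintegral_enorm_fejer_le (hm : ∀ k, 2 ≤ m k) {b : ℕ} (hb : ∀ k, m k ≤ b) {j l : ℕ}
    (hl : l ≤ M m j) : ∫⁻ x, ‖fejer m l x‖ₑ ∂μ m ≤ (4 * b ^ 2 * M m j : ℕ) := by
  have hb_pos : 1 ≤ b := (NeZero.pos (m 0)).trans_le (hb 0)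
  induction j generalizing l with
  | zero => simp [fejer_of_le_one hl]
  | succ j ih =>
    rcases hl.eq_or_lt with rfl | hlt
    · refine (lintegral_enorm_fejer_M_le hm hb (j + 1)).trans ?_
      norm_cast
      gcongr ?_ * _
      nlinarith
    have hs : l / M m j < m j := Nat.div_lt_of_lt_mul (by simpa [M, mul_comm] using hlt)
    have hr : l % M m j ≤ M m j := (Nat.mod_lt _ (M_pos j)).le
    have hsb := hs.le.trans (hb j)
    rw [← Nat.div_add_mod' l (M m j)]
    refine (lintegral_enorm_fejer_mul_add_le hm hr hs).trans ?_
    generalize l / M m j = s at hs hsb ⊢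
    generalize l % M m j = r at hr ⊢
    calc
      _ ≤ ((M m j * s ^ 2 + r * s : ℕ) : ℝ≥0∞) + s * (2 * b * M m j : ℕ) +
          (4 * b ^ 2 * M m j : ℕ) := by
        gcongr
        exacts [lintegral_enorm_fejer_M_le hm hb j, ih hr]
      _ ≤ ((M m j * b ^ 2 + M m j * (b * b) : ℕ) : ℝ≥0∞) + b * (2 * b * M m j : ℕ) +
          (4 * b ^ 2 * M m j : ℕ) := by
        have hrs : r * s ≤ M m j * (b * b) := Nat.mul_le_mul hr (by nlinarith)
        gcongr
      _ = (4 * b ^ 2 * (2 * M m j) : ℕ) := by push_cast; ring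
      _ ≤ (4 * b ^ 2 * M m (j + 1) : ℕ) := by
        rw [M]
        gcongr
        exact hm j

end Kernels

end Vilenkin

section AbelSummation

variable {X E : Type*} [MeasurableSpace X] {μ : Measure X} [NormedAddCommGroup E] [NormedSpace ℝ E]
  {p : ℝ≥0∞} {q : ℕ → ℝ} {u : ℕ → X → E}

theorem eLpNorm_sum_Ico_smul_sub_le_of_antitone (hp : 1 ≤ p)
    (hu : ∀ k, AEStronglyMeasurable (u k) μ) (hq : Antitone q) {a b : ℕ} {B : ℝ≥0∞}
    (hB : ∀ l ∈ Set.Icc a b, eLpNorm (∑ k ∈ Finset.Ico a l, u k) p μ ≤ B) {l : ℕ}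
    (hl : l ∈ Set.Icc a b) :
    eLpNorm (∑ k ∈ Finset.Ico a l, q k • u k - q l • ∑ k ∈ Finset.Ico a l, u k) p μ ≤
      ENNReal.ofReal (q a - q l) * B := by
  obtain ⟨hal, hlb⟩ := hl
  induction l, hal using Nat.le_induction with
  | base => simp
  | succ l hal ih =>
    have hU : ∀ l, AEStronglyMeasurable (∑ k ∈ Finset.Ico a l, u k) μ := fun l =>
      Finset.aestronglyMeasurable_sum _ fun k _ => hu k
    have hqU : AEStronglyMeasurable (∑ k ∈ Finset.Ico a l, q k • u k) μ :=
      Finset.aestronglyMeasurable_sum _ fun k _ => (hu k).const_smul (q k)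
    have hstep : ∑ k ∈ Finset.Ico a (l + 1), q k • u k -
        q (l + 1) • ∑ k ∈ Finset.Ico a (l + 1), u k =
        (∑ k ∈ Finset.Ico a l, q k • u k - q l • ∑ k ∈ Finset.Ico a l, u k) +
          (q l - q (l + 1)) • ∑ k ∈ Finset.Ico a (l + 1), u k := by
      rw [Finset.sum_Ico_succ_top hal, Finset.sum_Ico_succ_top hal]
      module
    have hdrop : 0 ≤ q l - q (l + 1) := sub_nonneg.2 (hq l.le_succ)
    rw [hstep]
    refine (eLpNorm_add_le (hqU.sub ((hU l).const_smul _)) ((hU _).const_smul _) hp).trans ?_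
    rw [eLpNorm_const_smul, Real.enorm_of_nonneg hdrop]
    calc _ ≤ ENNReal.ofReal (q a - q l) * B + ENNReal.ofReal (q l - q (l + 1)) * B := by
          gcongr
          exacts [ih (Nat.le_of_succ_le hlb), hB (l + 1) ⟨Nat.le_succ_of_le hal, hlb⟩]
      _ = ENNReal.ofReal (q a - q (l + 1)) * B := by
          rw [← add_mul, ← ENNReal.ofReal_add (sub_nonneg.2 (hq hal)) hdrop, sub_add_sub_cancel]

theorem eLpNorm_sum_Ico_smul_le_of_antitone (hp : 1 ≤ p)
    (hu : ∀ k, AEStronglyMeasurable (u k) μ) (hq0 : ∀ k, 0 ≤ q k) (hq : Antitone q) {a b : ℕ}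
    (hab : a ≤ b) {B : ℝ≥0∞}
    (hB : ∀ l ∈ Set.Icc a b, eLpNorm (∑ k ∈ Finset.Ico a l, u k) p μ ≤ B) :
    eLpNorm (∑ k ∈ Finset.Ico a b, q k • u k) p μ ≤ ENNReal.ofReal (q a) * B := by
  have hb : b ∈ Set.Icc a b := Set.right_mem_Icc.2 hab
  have hU : AEStronglyMeasurable (∑ k ∈ Finset.Ico a b, u k) μ :=
    Finset.aestronglyMeasurable_sum _ fun k _ => hu k
  have hqU : AEStronglyMeasurable (∑ k ∈ Finset.Ico a b, q k • u k) μ :=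
    Finset.aestronglyMeasurable_sum _ fun k _ => (hu k).const_smul (q k)
  rw [← sub_add_cancel (∑ k ∈ Finset.Ico a b, q k • u k) (q b • ∑ k ∈ Finset.Ico a b, u k)]
  refine (eLpNorm_add_le (hqU.sub (hU.const_smul _)) (hU.const_smul _) hp).trans ?_
  rw [eLpNorm_const_smul, Real.enorm_of_nonneg (hq0 b)]
  calc _ ≤ ENNReal.ofReal (q a - q b) * B + ENNReal.ofReal (q b) * B := by
        gcongr
        exacts [eLpNorm_sum_Ico_smul_sub_le_of_antitone hp hu hq hB hb, hB b hb]
    _ = ENNReal.ofReal (q a) * B := by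
        rw [← add_mul, ← ENNReal.ofReal_add (sub_nonneg.2 (hq hab)) (hq0 b), sub_add_cancel]

theorem eLpNorm_sum_Ico_smul_le_sum_blocks (hp : 1 ≤ p)
    (hu : ∀ k, AEStronglyMeasurable (u k) μ) (hq0 : ∀ k, 0 ≤ q k) (hq : Antitone q) {N : ℕ → ℕ}
    (hN : Monotone N) {B : ℕ → ℝ≥0∞}
    (hB : ∀ j, ∀ l ∈ Set.Icc (N j) (N (j + 1)),
      eLpNorm (∑ k ∈ Finset.Ico (N j) l, u k) p μ ≤ B j)
    {J n : ℕ} (hn : n ∈ Set.Icc (N J) (N (J + 1))) :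
    eLpNorm (∑ k ∈ Finset.Ico (N 0) n, q k • u k) p μ ≤
      ∑ j ∈ Finset.range (J + 1), ENNReal.ofReal (q (N j)) * B j := by
  have hlast : eLpNorm (∑ k ∈ Finset.Ico (N J) n, q k • u k) p μ ≤
      ENNReal.ofReal (q (N J)) * B J :=
    eLpNorm_sum_Ico_smul_le_of_antitone hp hu hq0 hq hn.1 fun l hl =>
      hB J l ⟨hl.1, hl.2.trans hn.2⟩
  have hmeas : ∀ a b, AEStronglyMeasurable (∑ k ∈ Finset.Ico a b, q k • u k) μ := fun a b =>
    Finset.aestronglyMeasurable_sum _ fun k _ => (hu k).const_smul (q k)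
  induction J generalizing n with
  | zero => simpa using hlast
  | succ J ih =>
    have hJ : N (J + 1) ∈ Set.Icc (N J) (N (J + 1)) := Set.right_mem_Icc.2 (hN J.le_succ)
    rw [← Finset.sum_Ico_consecutive _ (hN (Nat.zero_le (J + 1))) hn.1, Finset.sum_range_succ]
    refine (eLpNorm_add_le (hmeas _ _) (hmeas _ _) hp).trans (add_le_add (ih hJ ?_) hlast)
    exact eLpNorm_sum_Ico_smul_le_of_antitone hp hu hq0 hq hJ.1 (hB J)

end AbelSummation

namespace Vilenkin

section Oscillation

variable {m : ℕ → ℕ} [∀ k, NeZero (m k)] {p : ℝ≥0∞} {f : G m → ℂ}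

theorem val_div_M_succ_le (x : G m) (k : ℕ) :
    ((x k).val : ℝ) / M m (k + 1) ≤ (M m k : ℝ)⁻¹ - (M m (k + 1) : ℝ)⁻¹ := by
  have hm : (0 : ℝ) < m k := Nat.cast_pos.2 (NeZero.pos (m k))
  have hM : (0 : ℝ) < M m k := Nat.cast_pos.2 (M_pos k)
  have hval : ((x k).val : ℝ) + 1 ≤ m k := mod_cast ZMod.val_lt (x k)
  rw [M, Nat.cast_mul]
  field_simp
  linarith

theorem size_le_inv_M {j : ℕ} {t : G m} (ht : ∀ k < j, t k = 0) :
    size m t ≤ (M m j : ℝ)⁻¹ := by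
  let c : ℕ → ℝ := fun k => (M m (max k j) : ℝ)⁻¹
  have hterm : ∀ k, ((t k).val : ℝ) / M m (k + 1) ≤ c k - c (k + 1) := fun k => by
    rcases lt_or_ge k j with hk | hk
    · simp [c, ht k hk, max_eq_right hk.le, max_eq_right (Nat.succ_le_of_lt hk)]
    · simpa only [c, max_eq_left hk, max_eq_left (Nat.le_succ_of_le hk)] using
        val_div_M_succ_le t k
  refine Real.tsum_le_of_sum_range_le (fun k => by positivity) fun n => ?_
  calc ∑ k ∈ Finset.range n, ((t k).val : ℝ) / M m (k + 1)
      ≤ ∑ k ∈ Finset.range n, (c k - c (k + 1)) := Finset.sum_le_sum fun k _ => hterm k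
    _ = c 0 - c n := Finset.sum_range_sub' c n
    _ ≤ c 0 := sub_le_self _ (by positivity)
    _ = (M m j : ℝ)⁻¹ := by simp only [c, Nat.zero_max]

/-- The `L^p` modulus of continuity of `f` over the subgroup `I_j = {t | t_0 = ⋯ = t_{j-1} = 0}`;
unlike `modulus`, it does not involve the size of `t`. -/
noncomputable def oscillation (p : ℝ≥0∞) (j : ℕ) (f : G m → ℂ) : ℝ≥0∞ :=
  ⨆ (t : G m) (_ : ∀ k < j, t k = 0), eLpNorm (fun x => f (x - t) - f x) p (μ m)

theorem oscillation_le_modulus {j : ℕ} {δ : ℝ} (hδ : (M m j : ℝ)⁻¹ < δ) :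
    oscillation p j f ≤ modulus m p δ f :=
  iSup₂_mono' fun t ht => ⟨t, (size_le_inv_M ht).trans_lt hδ, le_rfl⟩

theorem eLpNorm_comp_sub (hf : AEStronglyMeasurable f (μ m)) (t : G m) :
    eLpNorm (fun x => f (x - t)) p (μ m) = eLpNorm f p (μ m) :=
  eLpNorm_comp_measurePreserving hf (measurePreserving_sub_right (μ m) t)

theorem oscillation_le_two_mul_eLpNorm (hp : 1 ≤ p) (hf : AEStronglyMeasurable f (μ m)) (j : ℕ) :
    oscillation p j f ≤ 2 * eLpNorm f p (μ m) := by
  refine iSup₂_le fun t _ => ?_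
  have hshift : AEStronglyMeasurable (fun x => f (x - t)) (μ m) :=
    hf.comp_measurePreserving (measurePreserving_sub_right (μ m) t)
  refine (eLpNorm_sub_le hshift hf hp).trans_eq ?_
  rw [eLpNorm_comp_sub hf, two_mul]

end Oscillation

section Lipschitz

theorem tendsto_M_atTop {m : ℕ → ℕ} (hm : ∀ k, 2 ≤ m k) : Tendsto (M m) atTop atTop :=
  tendsto_atTop_mono (fun k => (lt_M hm k).le) tendsto_id

variable {m : ℕ → ℕ} [∀ k, NeZero (m k)] {p : ℝ≥0∞} {f : G m → ℂ}

theorem Lip.isBigO_oscillation (hm : ∀ k, 2 ≤ m k) {α : ℝ} (hf : Lip m α p f) :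
    (fun j => (oscillation p j f).toReal) =O[atTop] fun j => (M m j : ℝ) ^ (-α) := by
  obtain ⟨-, C, hC⟩ := hf
  have hM : ∀ j, (0 : ℝ) < M m j := fun j => Nat.cast_pos.2 (M_pos j)
  have hδ : Tendsto (fun j => 2 * (M m j : ℝ)⁻¹) atTop (𝓝[>] 0) := by
    refine tendsto_nhdsWithin_iff.2 ⟨?_, Eventually.of_forall fun j => mul_pos two_pos
      (inv_pos.2 (hM j))⟩
    simpa using (tendsto_inv_atTop_zero.comp
      (tendsto_natCast_atTop_atTop.comp (tendsto_M_atTop hm))).const_mul (2 : ℝ)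
  refine Asymptotics.IsBigO.of_bound (|C| * 2 ^ α) ?_
  filter_upwards [hδ.eventually hC] with j hj
  have hpow : (2 * (M m j : ℝ)⁻¹) ^ α = 2 ^ α * (M m j : ℝ) ^ (-α) := by
    rw [Real.mul_rpow zero_le_two (inv_nonneg.2 (hM j).le), Real.inv_rpow (hM j).le,
      Real.rpow_neg (hM j).le]
  rw [Real.norm_of_nonneg ENNReal.toReal_nonneg, Real.norm_of_nonneg (by positivity), mul_assoc,
    ← hpow]
  refine ENNReal.toReal_le_of_le_ofReal (by positivity) ?_
  refine ((oscillation_le_modulus ?_).trans hj).trans (by gcongr; exact le_abs_self C)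
  linarith [inv_pos.2 (hM j)]

theorem Lip.exists_oscillation_le (hm : ∀ k, 2 ≤ m k) (hp : 1 ≤ p) {α : ℝ} (hf : Lip m α p f) :
    ∃ D : ℝ, 0 ≤ D ∧ ∀ j, oscillation p j f ≤ ENNReal.ofReal (D * (M m j : ℝ) ^ (-α)) := by
  obtain ⟨D, hD, hosc⟩ := Asymptotics.bound_of_isBigO_nat_atTop (hf.isBigO_oscillation hm)
  refine ⟨D, hD.le, fun j => ?_⟩
  have hM : (0 : ℝ) < (M m j : ℝ) ^ (-α) := Real.rpow_pos_of_pos (Nat.cast_pos.2 (M_pos j)) _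
  have htop : oscillation p j f ≠ ∞ := ne_top_of_le_ne_top
    (ENNReal.mul_ne_top ENNReal.ofNat_ne_top hf.1.2.ne)
    (oscillation_le_two_mul_eLpNorm hp hf.1.1 j)
  rw [← ENNReal.ofReal_toReal htop]
  gcongr
  simpa only [Real.norm_of_nonneg ENNReal.toReal_nonneg, Real.norm_of_nonneg hM.le] using
    hosc hM.ne'

end Lipschitz

section PartialSums

variable {m : ℕ → ℕ} [∀ k, NeZero (m k)] {p : ℝ≥0∞} {f g : G m → ℂ}

theorem coeff_mul_ψ (f : G m → ℂ) (i : ℕ) (x : G m) :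
    coeff m f i * ψ m i x = ∫ t, ψ m i t * f (x - t) ∂μ m := by
  rw [coeff, ← integral_sub_left_eq_self _ (μ m) x, ← integral_mul_const]
  congr 1
  funext t
  rw [mul_assoc, mul_comm _ (ψ m i x), ψ_mul_conj_sub, mul_comm]

theorem integrable_ψ_mul_comp_sub (hf : Integrable f (μ m)) (x : G m) (i : ℕ) :
    Integrable (fun t => ψ m i t * f (x - t)) (μ m) :=
  (hf.comp_sub_left x).bdd_mul (measurable_ψ i).aestronglyMeasurable
    (Eventually.of_forall fun t => (norm_ψ i t).le)

theorem integrable_dirichlet_mul_comp_sub (hf : Integrable f (μ m)) (x : G m) (k : ℕ) :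
    Integrable (fun t => dirichlet m k t * f (x - t)) (μ m) := by
  simp_rw [dirichlet, Finset.sum_mul]
  exact integrable_finsetSum _ fun i _ => integrable_ψ_mul_comp_sub hf x i

theorem S_eq_integral (hf : Integrable f (μ m)) (k : ℕ) (x : G m) :
    S m f k x = ∫ t, dirichlet m k t * f (x - t) ∂μ m := by
  simp_rw [S, coeff_mul_ψ, dirichlet, Finset.sum_mul]
  rw [integral_finsetSum _ fun i _ => integrable_ψ_mul_comp_sub hf x i]

theorem sum_Ico_S_eq_integral (hf : Integrable f (μ m)) {a l : ℕ} (hal : a ≤ l) (x : G m) :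
    ∑ k ∈ Finset.Ico a l, S m f k x = ∫ t, (fejer m l t - fejer m a t) * f (x - t) ∂μ m := by
  simp_rw [S_eq_integral hf]
  rw [← integral_finsetSum _ fun k _ => integrable_dirichlet_mul_comp_sub hf x k]
  simp_rw [← Finset.sum_mul, Finset.sum_Ico_eq_sub _ hal, fejer]

theorem measurable_S (f : G m → ℂ) (k : ℕ) : Measurable (S m f k) :=
  Finset.measurable_sum _ fun i _ => (measurable_ψ i).const_mul _

theorem memLp_S (f : G m → ℂ) (k : ℕ) (p : ℝ≥0∞) : MemLp (S m f k) p (μ m) := by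
  refine MemLp.of_bound (measurable_S f k).aestronglyMeasurable
    (∑ i ∈ Finset.range k, ‖coeff m f i‖) (Eventually.of_forall fun x => ?_)
  refine (norm_sum_le _ _).trans (Finset.sum_le_sum fun i _ => ?_)
  rw [norm_mul, norm_ψ, mul_one]

theorem coeff_S (hm : ∀ k, 2 ≤ m k) (f : G m → ℂ) (n i : ℕ) :
    coeff m (S m f n) i = if i < n then coeff m f i else 0 := by
  have hint : ∀ k, Integrable (fun x => coeff m f k * (ψ m k x * (starRingEnd ℂ) (ψ m i x)))
      (μ m) := fun k => by
    refine ((integrable_ψ k).mul_bdd (c := 1) ?_ (Eventually.of_forall fun x => ?_)).const_mul _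
    · exact (Complex.continuous_conj.measurable.comp (measurable_ψ i)).aestronglyMeasurable
    · simp [norm_ψ]
  rw [coeff]
  simp_rw [S, Finset.sum_mul, mul_assoc]
  rw [integral_finsetSum _ fun k _ => hint k]
  simp_rw [integral_const_mul, integral_ψ_mul_conj hm]
  simp

theorem S_S (hm : ∀ k, 2 ≤ m k) (f : G m → ℂ) {n k : ℕ} (h : n ≤ k) :
    S m (S m f n) k = S m f n := by
  funext x
  rw [S, S]
  simp only [coeff_S hm, ite_mul, zero_mul]
  rw [← Finset.sum_filter]
  congr 1
  ext i
  simp only [Finset.mem_filter, Finset.mem_range]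
  omega

theorem S_sub (hf : Integrable f (μ m)) (hg : Integrable g (μ m)) (k : ℕ) :
    S m (f - g) k = S m f k - S m g k := by
  funext x
  rw [Pi.sub_apply, S_eq_integral (hf.sub hg), S_eq_integral hf, S_eq_integral hg,
    ← integral_sub (integrable_dirichlet_mul_comp_sub hf x k)
      (integrable_dirichlet_mul_comp_sub hg x k)]
  simp only [Pi.sub_apply, mul_sub]

theorem aestronglyMeasurable_comp_sub (hf : AEStronglyMeasurable f (μ m)) :
    AEStronglyMeasurable (fun z : G m × G m => f (z.1 - z.2)) ((μ m).prod (μ m)) :=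
  hf.comp_quasiMeasurePreserving (quasiMeasurePreserving_sub (μ m) (μ m))

theorem S_M_sub_eq_integral (hm : ∀ k, 2 ≤ m k) (hf : Integrable f (μ m)) (j : ℕ) :
    S m f (M m j) - f = fun x => ∫ t, dirichlet m (M m j) t * (f (x - t) - f x) ∂μ m := by
  funext x
  simp_rw [mul_sub]
  rw [integral_sub (integrable_dirichlet_mul_comp_sub hf x _)
    ((integrable_dirichlet _).mul_const _), integral_mul_const,
    integral_dirichlet hm (M_pos j), one_mul, Pi.sub_apply, S_eq_integral hf]

theorem eLpNorm_sub_S_M_le (hm : ∀ k, 2 ≤ m k) (hp : 1 ≤ p) (hf : MemLp f p (μ m)) (j : ℕ) :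
    eLpNorm (f - S m f (M m j)) p (μ m) ≤ oscillation p j f := by
  rw [eLpNorm_sub_comm, S_M_sub_eq_integral hm (hf.integrable hp)]
  have hshift : AEStronglyMeasurable (fun z : G m × G m => f (z.1 - z.2) - f z.1)
      ((μ m).prod (μ m)) := (aestronglyMeasurable_comp_sub hf.1).sub hf.1.comp_fst
  have hsupp : ∀ t, dirichlet m (M m j) t ≠ 0 →
      eLpNorm (fun x => f (x - t) - f x) p (μ m) ≤ oscillation p j f := fun t ht =>
    le_iSup₂_of_le t (by by_contra h; exact ht (by rw [dirichlet_M hm, if_neg h])) le_rfl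
  simpa only [smul_eq_mul, lintegral_enorm_dirichlet_M hm, mul_one] using
    eLpNorm_integral_smul_le hp hshift (integrable_dirichlet (M m j)) hsupp

theorem lintegral_enorm_fejer_sub_le (hm : ∀ k, 2 ≤ m k) {b : ℕ} (hb : ∀ k, m k ≤ b)
    {a l j : ℕ} (ha : a ≤ M m j) (hl : l ≤ M m j) :
    ∫⁻ t, ‖fejer m l t - fejer m a t‖ₑ ∂μ m ≤ (8 * b ^ 2 * M m j : ℕ) := by
  calc ∫⁻ t, ‖fejer m l t - fejer m a t‖ₑ ∂μ m
      ≤ ∫⁻ t, ‖fejer m l t‖ₑ + ‖fejer m a t‖ₑ ∂μ m := lintegral_mono fun t => enorm_sub_le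
    _ = ∫⁻ t, ‖fejer m l t‖ₑ ∂μ m + ∫⁻ t, ‖fejer m a t‖ₑ ∂μ m :=
        lintegral_add_left (measurable_fejer l).enorm _
    _ ≤ (4 * b ^ 2 * M m j : ℕ) + (4 * b ^ 2 * M m j : ℕ) :=
        add_le_add (lintegral_enorm_fejer_le hm hb hl) (lintegral_enorm_fejer_le hm hb ha)
    _ = (8 * b ^ 2 * M m j : ℕ) := by push_cast; ring

theorem eLpNorm_sum_Ico_S_le (hm : ∀ k, 2 ≤ m k) {b : ℕ} (hb : ∀ k, m k ≤ b) (hp : 1 ≤ p)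
    (hf : MemLp f p (μ m)) {a l j : ℕ} (hal : a ≤ l) (hl : l ≤ M m j) :
    eLpNorm (∑ k ∈ Finset.Ico a l, S m f k) p (μ m) ≤
      (8 * b ^ 2 * M m j : ℕ) * eLpNorm f p (μ m) := by
  have hconv : ∑ k ∈ Finset.Ico a l, S m f k =
      fun x => ∫ t, (fejer m l t - fejer m a t) • f (x - t) ∂μ m := by
    funext x
    rw [Finset.sum_apply, sum_Ico_S_eq_integral (hf.integrable hp) hal]
    simp only [smul_eq_mul]
  rw [hconv, mul_comm]
  refine (eLpNorm_integral_smul_le hp (aestronglyMeasurable_comp_sub hf.1)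
    ((integrable_fejer l).sub (integrable_fejer a))
    fun t _ => (eLpNorm_comp_sub hf.1 t).le).trans ?_
  gcongr
  exact lintegral_enorm_fejer_sub_le hm hb (hal.trans hl) hl

theorem eLpNorm_sum_Ico_S_sub_le (hm : ∀ k, 2 ≤ m k) {b : ℕ} (hb : ∀ k, m k ≤ b) (hp : 1 ≤ p)
    (hf : MemLp f p (μ m)) {j l : ℕ} (hl : l ∈ Set.Icc (M m j) (M m (j + 1))) :
    eLpNorm (∑ k ∈ Finset.Ico (M m j) l, (S m f k - f)) p (μ m) ≤
      ((8 * b ^ 2 + 1) * M m (j + 1) : ℕ) * oscillation p j f := by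
  -- For `k ≥ M_j`, `S_k` reproduces `S_{M_j} f`, so `f` may be replaced by `f - S_{M_j} f`, whose
  -- norm is at most the oscillation.
  set g := f - S m f (M m j)
  have hg : MemLp g p (μ m) := hf.sub (memLp_S f _ p)
  have hSg : ∀ k ∈ Finset.Ico (M m j) l, S m f k - f = S m g k - g := fun k hk => by
    rw [S_sub (hf.integrable hp) ((memLp_S f _ 1).integrable le_rfl),
      S_S hm f (Finset.mem_Ico.1 hk).1, sub_sub_sub_cancel_right]
  have hsum : ∑ k ∈ Finset.Ico (M m j) l, (S m f k - f) =
      ∑ k ∈ Finset.Ico (M m j) l, S m g k - (l - M m j) • g := by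
    rw [Finset.sum_congr rfl hSg, Finset.sum_sub_distrib, Finset.sum_const, Nat.card_Ico]
  have hmeas : AEStronglyMeasurable (∑ k ∈ Finset.Ico (M m j) l, S m g k) (μ m) :=
    Finset.aestronglyMeasurable_sum _ fun k _ => (measurable_S g k).aestronglyMeasurable
  have hconst : eLpNorm ((l - M m j) • g) p (μ m) ≤ M m (j + 1) * eLpNorm g p (μ m) := by
    rw [eLpNorm_nsmul]
    gcongr
    exact (Nat.sub_le _ _).trans hl.2
  rw [hsum]
  refine (eLpNorm_sub_le hmeas (hg.1.const_smul _) hp).trans ?_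
  calc _ ≤ (8 * b ^ 2 * M m (j + 1) : ℕ) * eLpNorm g p (μ m) + M m (j + 1) * eLpNorm g p (μ m) :=
        add_le_add (eLpNorm_sum_Ico_S_le hm hb hp hg hl.1 hl.2) hconst
    _ = ((8 * b ^ 2 + 1) * M m (j + 1) : ℕ) * eLpNorm g p (μ m) := by push_cast; ring
    _ ≤ _ := by gcongr; exact eLpNorm_sub_S_M_le hm hp hf j

end PartialSums

section Level

variable {m : ℕ → ℕ} {n : ℕ}

/-- The index `j` of the block `[M_j, M_{j+1})` containing `n`, with junk value `0` at `n = 0`. -/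
def level (m : ℕ → ℕ) (n : ℕ) : ℕ := Nat.findGreatest (fun j => M m j ≤ n) n

theorem M_level_le (hn : n ≠ 0) : M m (level m n) ≤ n :=
  Nat.findGreatest_spec (P := fun j => M m j ≤ n) (Nat.zero_le n) (Nat.one_le_iff_ne_zero.2 hn)

theorem lt_M_level_succ (hm : ∀ k, 2 ≤ m k) (n : ℕ) : n < M m (level m n + 1) := by
  by_contra! h
  exact (Nat.le_findGreatest (P := fun j => M m j ≤ n) ((lt_M hm _).le.trans h) h).not_gt
    (Nat.lt_succ_self _)

end Level

section Means

variable {m : ℕ → ℕ} [∀ k, NeZero (m k)] {p : ℝ≥0∞} {f : G m → ℂ} {q : ℕ → ℝ} {n : ℕ}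

theorem T_sub_eq (hQ : ∑ k ∈ Finset.range n, q k ≠ 0) :
    (fun x => T m q f n x - f x) =
      (∑ k ∈ Finset.range n, q k)⁻¹ • ∑ k ∈ Finset.range n, q k • (S m f k - f) := by
  funext x
  have hQ' : ((∑ k ∈ Finset.range n, q k : ℝ) : ℂ) ≠ 0 := Complex.ofReal_ne_zero.2 hQ
  simp only [T, Pi.smul_apply, Finset.sum_apply, Pi.sub_apply, Complex.real_smul, mul_sub,
    Finset.sum_sub_distrib, ← Finset.sum_mul, Complex.ofReal_inv]
  rw [← Complex.ofReal_sum]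
  field_simp

theorem eLpNorm_sum_smul_S_sub_le (hm : ∀ k, 2 ≤ m k) {b : ℕ} (hb : ∀ k, m k ≤ b)
    (hq_nonneg : ∀ k, 0 ≤ q k) (hq_anti : Antitone q) (hp : 1 ≤ p) (hf : MemLp f p (μ m))
    (hn : n ≠ 0) :
    eLpNorm (∑ k ∈ Finset.range n, q k • (S m f k - f)) p (μ m) ≤
      ENNReal.ofReal (q 0) * eLpNorm f p (μ m) + ∑ j ∈ Finset.range (level m n + 1),
        ENNReal.ofReal (q (M m j)) * (((8 * b ^ 2 + 1) * M m (j + 1) : ℕ) * oscillation p j f) := by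
  have hu : ∀ k, AEStronglyMeasurable (S m f k - f) (μ m) := fun k =>
    (measurable_S f k).aestronglyMeasurable.sub hf.1
  have hzero : eLpNorm (q 0 • (S m f 0 - f)) p (μ m) =
      ENNReal.ofReal (q 0) * eLpNorm f p (μ m) := by
    have hS : S m f 0 = 0 := funext fun x => Finset.sum_range_zero _
    rw [eLpNorm_const_smul, Real.enorm_of_nonneg (hq_nonneg 0), hS, zero_sub, eLpNorm_neg]
  have hblocks := eLpNorm_sum_Ico_smul_le_sum_blocks hp hu hq_nonneg hq_anti M_mono
    (fun j l hl => eLpNorm_sum_Ico_S_sub_le hm hb hp hf hl)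
    ⟨M_level_le hn, (lt_M_level_succ hm n).le⟩
  rw [Finset.range_eq_Ico, Finset.sum_eq_sum_Ico_succ_bot (Nat.pos_of_ne_zero hn), ← hzero]
  refine (eLpNorm_add_le ((hu 0).const_smul _) ?_ hp).trans (add_le_add le_rfl hblocks)
  exact Finset.aestronglyMeasurable_sum _ fun k _ => (hu k).const_smul (q k)

theorem Lip.exists_M_succ_mul_oscillation_le (hm : ∀ k, 2 ≤ m k) (hbdd : BddAbove (Set.range m))
    (hp : 1 ≤ p) {α : ℝ} (hf : Lip m α p f) (c : ℕ) :
    ∃ K : ℝ, 0 ≤ K ∧ ∀ j, (c * M m (j + 1) : ℕ) * oscillation p j f ≤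
      ENNReal.ofReal (K * (M m j : ℝ) ^ (1 - α)) := by
  obtain ⟨b, hb⟩ := hbdd
  obtain ⟨D, hD, hosc⟩ := hf.exists_oscillation_le hm hp
  refine ⟨c * b * D, by positivity, fun j => ?_⟩
  have hM : (0 : ℝ) < M m j := Nat.cast_pos.2 (M_pos j)
  have hMb : c * M m (j + 1) ≤ c * (b * M m j) :=
    Nat.mul_le_mul_left _ (Nat.mul_le_mul_right _ (hb ⟨j, rfl⟩))
  calc (c * M m (j + 1) : ℕ) * oscillation p j f
      ≤ (c * (b * M m j) : ℕ) * ENNReal.ofReal (D * (M m j : ℝ) ^ (-α)) :=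
        mul_le_mul' (Nat.cast_le.2 hMb) (hosc j)
    _ = ENNReal.ofReal (c * b * D * (M m j : ℝ) ^ (1 - α)) := by
        rw [← ENNReal.ofReal_natCast, ← ENNReal.ofReal_mul (Nat.cast_nonneg _), sub_eq_add_neg,
          Real.rpow_add hM, Real.rpow_one, Nat.cast_mul, Nat.cast_mul]
        ring_nf

theorem Lip.exists_eLpNorm_sum_smul_S_sub_le (hm : ∀ k, 2 ≤ m k) (hbdd : BddAbove (Set.range m))
    (hq_nonneg : ∀ k, 0 ≤ q k) (hq_anti : Antitone q) (hp : 1 ≤ p) {α : ℝ} (hf : Lip m α p f) :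
    ∃ A : ℝ, ∀ n ≠ 0, eLpNorm (∑ k ∈ Finset.range n, q k • (S m f k - f)) p (μ m) ≤
      ENNReal.ofReal
        (A * (1 + ∑ j ∈ Finset.range (level m n + 1), q (M m j) * (M m j : ℝ) ^ (1 - α))) := by
  have ⟨b, hb⟩ := hbdd
  obtain ⟨K, hK, hosc⟩ := hf.exists_M_succ_mul_oscillation_le hm hbdd hp (8 * b ^ 2 + 1)
  set F : ℝ := (eLpNorm f p (μ m)).toReal
  have hF : 0 ≤ q 0 * F := mul_nonneg (hq_nonneg 0) ENNReal.toReal_nonneg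
  have hterm : ∀ j, 0 ≤ q (M m j) * (M m j : ℝ) ^ (1 - α) := fun j =>
    mul_nonneg (hq_nonneg _) (by positivity)
  refine ⟨q 0 * F + K, fun n hn => ?_⟩
  have hsum := Finset.sum_nonneg fun j (_ : j ∈ Finset.range (level m n + 1)) => hterm j
  calc _ ≤ _ := eLpNorm_sum_smul_S_sub_le hm (fun k => hb ⟨k, rfl⟩) hq_nonneg hq_anti hp hf.1 hn
    _ ≤ ENNReal.ofReal (q 0 * F) + ∑ j ∈ Finset.range (level m n + 1),
          ENNReal.ofReal (K * (q (M m j) * (M m j : ℝ) ^ (1 - α))) := by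
      rw [ENNReal.ofReal_mul (hq_nonneg 0), ENNReal.ofReal_toReal hf.1.2.ne]
      refine add_le_add le_rfl (Finset.sum_le_sum fun j _ => ?_)
      rw [mul_left_comm K, ENNReal.ofReal_mul (hq_nonneg _)]
      gcongr
      exact hosc j
    _ = ENNReal.ofReal (q 0 * F + K * ∑ j ∈ Finset.range (level m n + 1),
          q (M m j) * (M m j : ℝ) ^ (1 - α)) := by
      rw [← ENNReal.ofReal_sum_of_nonneg fun j _ => mul_nonneg hK (hterm j), ← Finset.mul_sum,
        ENNReal.ofReal_add hF (mul_nonneg hK hsum)]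
    _ ≤ _ := ENNReal.ofReal_le_ofReal (by nlinarith [mul_nonneg hF hsum])

theorem Lip.exists_eLpNorm_T_sub_le (hm : ∀ k, 2 ≤ m k) (hbdd : BddAbove (Set.range m))
    (hq_nonneg : ∀ k, 0 ≤ q k) (hq_anti : Antitone q) (hp : 1 ≤ p) {α : ℝ} (hf : Lip m α p f) :
    ∃ A : ℝ, ∀ n, 0 < ∑ k ∈ Finset.range n, q k →
      eLpNorm (fun x => T m q f n x - f x) p (μ m) ≤ ENNReal.ofReal (A *
        ((∑ k ∈ Finset.range n, q k)⁻¹ *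
          (1 + ∑ j ∈ Finset.range (level m n + 1), q (M m j) * (M m j : ℝ) ^ (1 - α)))) := by
  obtain ⟨A, hA⟩ := hf.exists_eLpNorm_sum_smul_S_sub_le hm hbdd hq_nonneg hq_anti hp
  refine ⟨A, fun n hQ => ?_⟩
  have hn : n ≠ 0 := by
    rintro rfl
    simp at hQ
  rw [T_sub_eq hQ.ne', eLpNorm_const_smul, Real.enorm_of_nonneg (inv_nonneg.2 hQ.le),
    mul_left_comm, ENNReal.ofReal_mul (inv_nonneg.2 hQ.le)]
  gcongr
  exact hA n hn

end Means

end Vilenkin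

section GeometricSums

variable {a : ℕ → ℝ} {r : ℝ}

theorem sum_range_succ_le_of_mul_le_succ (hr : 1 < r) (ha : 0 ≤ a 0)
    (h : ∀ j, r * a j ≤ a (j + 1)) (J : ℕ) :
    ∑ j ∈ Finset.range (J + 1), a j ≤ r / (r - 1) * a J := by
  have hr' : 0 < r - 1 := sub_pos.2 hr
  induction J with
  | zero =>
    rw [zero_add, Finset.sum_range_one]
    exact le_mul_of_one_le_left ha ((one_le_div hr').2 (by linarith))
  | succ J ih =>
    rw [Finset.sum_range_succ]
    calc _ ≤ (r - 1)⁻¹ * (r * a J) + a (J + 1) := by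
          rw [← mul_assoc, inv_mul_eq_div]
          gcongr
      _ ≤ (r - 1)⁻¹ * a (J + 1) + a (J + 1) := by gcongr; exact h J
      _ = r / (r - 1) * a (J + 1) := by field_simp; ring

theorem sum_range_le_of_succ_le_mul (hr0 : 0 ≤ r) (hr1 : r < 1) (ha : 0 ≤ a 0)
    (h : ∀ j, a (j + 1) ≤ r * a j) (J : ℕ) :
    ∑ j ∈ Finset.range J, a j ≤ (1 - r)⁻¹ * a 0 := by
  refine (Finset.sum_le_sum fun j _ => le_geom hr0 j fun k _ => h k).trans ?_
  rw [← Finset.sum_mul]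
  gcongr
  exact sum_le_hasSum _ (fun j _ => pow_nonneg hr0 j) (hasSum_geometric_of_lt_one hr0 hr1)

end GeometricSums

section Weights

variable {q : ℕ → ℝ} {β : ℝ}

theorem pos_of_antitone_of_rpow_isBigO (hq_nonneg : ∀ k, 0 ≤ q k) (hq_anti : Antitone q)
    (hq : (fun k : ℕ => (k : ℝ) ^ (-β)) =O[atTop] q) (k : ℕ) : 0 < q k := by
  obtain ⟨l, ⟨hl, hl0⟩, hkl⟩ :=
    ((hq.eq_zero_imp.and (eventually_gt_atTop 0)).and (eventually_ge_atTop k)).exists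
  refine ((hq_nonneg l).lt_of_ne fun h => ?_).trans_le (hq_anti hkl)
  exact (Real.rpow_pos_of_pos (Nat.cast_pos.2 hl0) _).ne' (hl h.symm)

theorem sum_range_pos (hq_pos : ∀ k, 0 < q k) {n : ℕ} (hn : n ≠ 0) :
    0 < ∑ k ∈ Finset.range n, q k :=
  Finset.sum_pos (fun k _ => hq_pos k) (Finset.nonempty_range_iff.2 hn)

theorem inv_sum_range_isBigO_rpow (hq_nonneg : ∀ k, 0 ≤ q k) (hq_anti : Antitone q)
    (hq : (fun k : ℕ => (k : ℝ) ^ (-β)) =O[atTop] q) :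
    (fun n => (∑ k ∈ Finset.range n, q k)⁻¹) =O[atTop] fun n : ℕ => (n : ℝ) ^ (-(1 - β)) := by
  have hle : ∀ n : ℕ, n * q n ≤ ∑ k ∈ Finset.range n, q k := fun n => by
    rw [← nsmul_eq_mul]
    simpa only [Finset.card_range] using
      Finset.card_nsmul_le_sum _ q (q n) fun k hk => hq_anti (Finset.mem_range.1 hk).le
  have hQ : (fun n : ℕ => (n : ℝ) ^ (1 - β)) =O[atTop] fun n => ∑ k ∈ Finset.range n, q k := by
    refine (((Asymptotics.isBigO_refl (fun n : ℕ => (n : ℝ)) atTop).mul hq).congr' ?_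
      EventuallyEq.rfl).trans (Asymptotics.isBigO_of_le _ fun n => ?_)
    · filter_upwards [eventually_gt_atTop 0] with n hn
      rw [sub_eq_add_neg, Real.rpow_add (Nat.cast_pos.2 hn), Real.rpow_one]
    · have hnq : 0 ≤ n * q n := mul_nonneg n.cast_nonneg (hq_nonneg n)
      rw [Real.norm_of_nonneg hnq, Real.norm_of_nonneg (hnq.trans (hle n))]
      exact hle n
  refine (hQ.inv_rev ?_).congr_right fun n => (Real.rpow_neg n.cast_nonneg _).symm
  filter_upwards [eventually_gt_atTop 0] with n hn h
  exact absurd h (Real.rpow_pos_of_pos (Nat.cast_pos.2 hn) _).ne'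

theorem inv_sum_range_isBigO_inv_log (hq_nonneg : ∀ k, 0 ≤ q k) (hq_anti : Antitone q)
    (hq : (fun k : ℕ => (k : ℝ) ^ (-1 : ℝ)) =O[atTop] q) :
    (fun n => (∑ k ∈ Finset.range n, q k)⁻¹) =O[atTop] fun n : ℕ => (Real.log n)⁻¹ := by
  have hpos := pos_of_antitone_of_rpow_isBigO hq_nonneg hq_anti hq
  obtain ⟨C, hC, hCq⟩ := Asymptotics.bound_of_isBigO_nat_atTop hq
  have hterm : ∀ k : ℕ, ((k + 1 : ℕ) : ℝ)⁻¹ ≤ C * q k := fun k => by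
    have h := hCq (hpos (k + 1)).ne'
    rw [Real.rpow_neg_one, Real.norm_of_nonneg (by positivity),
      Real.norm_of_nonneg (hq_nonneg _)] at h
    exact h.trans (by gcongr; exact hq_anti k.le_succ)
  refine Asymptotics.IsBigO.inv_rev (Asymptotics.IsBigO.of_bound C ?_) ?_
  · filter_upwards [eventually_ge_atTop 1] with n hn
    rw [Real.norm_of_nonneg (Real.log_nonneg (Nat.one_le_cast.2 hn)),
      Real.norm_of_nonneg (Finset.sum_nonneg fun k _ => hq_nonneg k), Finset.mul_sum]
    calc Real.log n ≤ Real.log (n + 1 : ℕ) := by gcongr; exact n.le_succ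
      _ ≤ harmonic n := log_add_one_le_harmonic n
      _ = ∑ k ∈ Finset.range n, ((k + 1 : ℕ) : ℝ)⁻¹ := by simp [harmonic]
      _ ≤ _ := Finset.sum_le_sum fun k _ => hterm k
  · filter_upwards [eventually_gt_atTop 1] with n hn h
    exact absurd h (Real.log_pos (Nat.one_lt_cast.2 hn)).ne'

end Weights

theorem exists_eventually_le_ofReal_mul {e : ℕ → ℝ≥0∞} {φ g : ℕ → ℝ} {A : ℝ}
    (he : ∀ᶠ n in atTop, e n ≤ ENNReal.ofReal (A * φ n)) (hφ : φ =O[atTop] g)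
    (hg : ∀ᶠ n in atTop, 0 ≤ g n) :
    ∃ C : ℝ, ∀ᶠ n in atTop, e n ≤ ENNReal.ofReal (C * g n) := by
  obtain ⟨C, hC⟩ := (hφ.const_mul_left A).bound
  refine ⟨C, ?_⟩
  filter_upwards [he, hC, hg] with n hen hCn hgn
  rw [Real.norm_of_nonneg hgn] at hCn
  exact hen.trans (ENNReal.ofReal_le_ofReal ((Real.le_norm_self _).trans hCn))

namespace Vilenkin

section Growth

variable {m : ℕ → ℕ} {γ : ℝ}

theorem two_mul_M_le (hm : ∀ k, 2 ≤ m k) (j : ℕ) : 2 * M m j ≤ M m (j + 1) :=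
  Nat.mul_le_mul_right _ (hm j)

theorem two_pow_le_M (hm : ∀ k, 2 ≤ m k) (j : ℕ) : 2 ^ j ≤ M m j := by
  induction j with
  | zero => rfl
  | succ j ih =>
    rw [pow_succ']
    exact (Nat.mul_le_mul_left 2 ih).trans (two_mul_M_le hm j)

theorem sum_M_rpow_isBigO_rpow (hm : ∀ k, 2 ≤ m k) (hγ : 0 < γ) :
    (fun n => ∑ j ∈ Finset.range (level m n + 1), (M m j : ℝ) ^ γ) =O[atTop]
      fun n : ℕ => (n : ℝ) ^ γ := by
  have hr : (1 : ℝ) < 2 ^ γ := Real.one_lt_rpow one_lt_two hγ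
  have hstep : ∀ j, (2 : ℝ) ^ γ * (M m j : ℝ) ^ γ ≤ (M m (j + 1) : ℝ) ^ γ := fun j => by
    rw [← Real.mul_rpow zero_le_two (Nat.cast_nonneg _)]
    gcongr
    exact_mod_cast two_mul_M_le hm j
  refine Asymptotics.IsBigO.of_bound (2 ^ γ / (2 ^ γ - 1)) ?_
  filter_upwards [eventually_ne_atTop 0] with n hn
  rw [Real.norm_of_nonneg (by positivity), Real.norm_of_nonneg (by positivity)]
  refine (sum_range_succ_le_of_mul_le_succ hr (by positivity) hstep _).trans ?_
  have := sub_pos.2 hr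
  gcongr
  exact M_level_le hn

theorem sum_M_rpow_isBigO_one (hm : ∀ k, 2 ≤ m k) (hγ : γ < 0) :
    (fun n => ∑ j ∈ Finset.range (level m n + 1), (M m j : ℝ) ^ γ) =O[atTop]
      fun _ => (1 : ℝ) := by
  have hstep : ∀ j, (M m (j + 1) : ℝ) ^ γ ≤ (2 : ℝ) ^ γ * (M m j : ℝ) ^ γ := fun j => by
    have hM : 0 < 2 * M m j := Nat.mul_pos two_pos ((Nat.zero_le j).trans_lt (lt_M hm j))
    rw [← Real.mul_rpow zero_le_two (Nat.cast_nonneg _)]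
    exact Real.rpow_le_rpow_of_nonpos (by exact_mod_cast hM) (by exact_mod_cast two_mul_M_le hm j)
      hγ.le
  refine Asymptotics.isBigO_of_le' (c := (1 - 2 ^ γ)⁻¹) _ fun n => ?_
  rw [Real.norm_of_nonneg (by positivity), norm_one]
  simpa [M] using sum_range_le_of_succ_le_mul (a := fun j => (M m j : ℝ) ^ γ) (by positivity)
    (Real.rpow_lt_one_of_one_lt_of_neg one_lt_two hγ) (by positivity) hstep (level m n + 1)

theorem level_isBigO_log (hm : ∀ k, 2 ≤ m k) :
    (fun n => (level m n : ℝ)) =O[atTop] fun n : ℕ => Real.log n := by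
  refine Asymptotics.IsBigO.of_bound (Real.log 2)⁻¹ ?_
  filter_upwards [eventually_ne_atTop 0] with n hn
  have hlevel : level m n ≤ Nat.log 2 n :=
    Nat.le_log_of_pow_le one_lt_two ((two_pow_le_M hm _).trans (M_level_le hn))
  rw [Real.norm_of_nonneg (Nat.cast_nonneg _), inv_mul_eq_div]
  calc (level m n : ℝ) ≤ Real.logb 2 n :=
        (Nat.cast_le.2 hlevel).trans (Real.natLog_le_logb n 2)
    _ ≤ _ := by
        rw [Real.logb]
        exact div_le_div_of_nonneg_right (Real.le_norm_self _) (Real.log_nonneg one_le_two)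

theorem sum_M_rpow_zero_isBigO_log (hm : ∀ k, 2 ≤ m k) :
    (fun n => ∑ j ∈ Finset.range (level m n + 1), (M m j : ℝ) ^ (0 : ℝ)) =O[atTop]
      fun n : ℕ => Real.log n := by
  have hone : (fun _ : ℕ => (1 : ℝ)) =O[atTop] fun n : ℕ => Real.log n :=
    (Real.isLittleO_const_log_atTop.comp_tendsto tendsto_natCast_atTop_atTop).isBigO
  simpa using (level_isBigO_log hm).add hone

theorem one_isBigO_sum_M_rpow :
    (fun _ => (1 : ℝ)) =O[atTop]
      fun n => ∑ j ∈ Finset.range (level m n + 1), (M m j : ℝ) ^ γ := by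
  refine Asymptotics.isBigO_of_le _ fun n => ?_
  have hnonneg : ∀ j, 0 ≤ (M m j : ℝ) ^ γ := fun j => Real.rpow_nonneg (Nat.cast_nonneg _) _
  rw [norm_one, Real.norm_of_nonneg (Finset.sum_nonneg fun j _ => hnonneg j)]
  simpa [M] using Finset.single_le_sum (fun j _ => hnonneg j)
    (Finset.mem_range.2 (level m n).succ_pos)

theorem sum_mul_M_rpow_isBigO {q : ℕ → ℝ} {β : ℝ} (hm : ∀ k, 2 ≤ m k)
    (hq : q =O[atTop] fun k : ℕ => (k : ℝ) ^ (-β)) :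
    (fun n => ∑ j ∈ Finset.range (level m n + 1), q (M m j) * (M m j : ℝ) ^ γ) =O[atTop]
      fun n => ∑ j ∈ Finset.range (level m n + 1), (M m j : ℝ) ^ (γ - β) := by
  obtain ⟨C, -, hqC⟩ := Asymptotics.bound_of_isBigO_nat_atTop hq
  have hterm : ∀ j, ‖q (M m j) * (M m j : ℝ) ^ γ‖ ≤ C * (M m j : ℝ) ^ (γ - β) := fun j => by
    have hM : (0 : ℝ) < M m j := Nat.cast_pos.2 ((Nat.zero_le j).trans_lt (lt_M hm j))
    have hpow := Real.rpow_pos_of_pos hM (-β)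
    rw [norm_mul, Real.norm_of_nonneg (Real.rpow_nonneg hM.le γ), sub_eq_neg_add,
      Real.rpow_add hM, ← mul_assoc]
    gcongr
    simpa only [Real.norm_of_nonneg hpow.le] using hqC hpow.ne'
  refine Asymptotics.isBigO_of_le' (c := C) _ fun n => ?_
  rw [Real.norm_of_nonneg (Finset.sum_nonneg fun j _ => Real.rpow_nonneg (Nat.cast_nonneg _) _),
    Finset.mul_sum]
  exact norm_sum_le_of_le _ fun j _ => hterm j

end Growth

theorem Lip.exists_eventually_eLpNorm_T_sub_le {m : ℕ → ℕ} [∀ k, NeZero (m k)]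
    (hm : ∀ k, 2 ≤ m k) (hbdd : BddAbove (Set.range m)) {q : ℕ → ℝ} (hq_nonneg : ∀ k, 0 ≤ q k)
    (hq_anti : Antitone q) {β : ℝ} (hq : q =Θ[atTop] fun k : ℕ => (k : ℝ) ^ (-β)) {p : ℝ≥0∞}
    (hp : 1 ≤ p) {f : G m → ℂ} {α : ℝ} (hf : Lip m α p f) {σ s g : ℕ → ℝ}
    (hσ : (fun n => (∑ k ∈ Finset.range n, q k)⁻¹) =O[atTop] σ)
    (hs : (fun n => ∑ j ∈ Finset.range (level m n + 1), (M m j : ℝ) ^ (1 - α - β)) =O[atTop] s)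
    (hσs : (fun n => σ n * s n) =O[atTop] g) (hg : ∀ᶠ n in atTop, 0 ≤ g n) :
    ∃ C : ℝ, ∀ᶠ n in atTop,
      eLpNorm (fun x => T m q f n x - f x) p (μ m) ≤ ENNReal.ofReal (C * g n) := by
  obtain ⟨A, hA⟩ := hf.exists_eLpNorm_T_sub_le hm hbdd hq_nonneg hq_anti hp
  have hq_pos := pos_of_antitone_of_rpow_isBigO hq_nonneg hq_anti hq.2
  refine exists_eventually_le_ofReal_mul (A := A) ?_
    ((hσ.mul ((one_isBigO_sum_M_rpow.add (sum_mul_M_rpow_isBigO hm hq.1)).trans hs)).trans hσs) hg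
  filter_upwards [eventually_ne_atTop 0] with n hn
  exact hA n (sum_range_pos hq_pos hn)

end Vilenkin

theorem corollary2_general (m : ℕ → ℕ) [∀ k, NeZero (m k)] (hm : ∀ k, 2 ≤ m k)
    (hbdd : BddAbove (Set.range m))
    (q : ℕ → ℝ) (hq_nonneg : ∀ k, 0 ≤ q k) (hq_anti : Antitone q)
    (β : ℝ) (hq : q =Θ[atTop] fun k : ℕ => (k : ℝ) ^ (-β))
    (α : ℝ) (hα : 0 < α) (p : ℝ≥0∞) (hp_one : 1 ≤ p)
    (f : Vilenkin.G m → ℂ) (hf : Vilenkin.Lip m α p f) :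
    (α + β < 1 →
      ∃ C : ℝ, ∀ᶠ n : ℕ in atTop,
        eLpNorm (fun x => Vilenkin.T m q f n x - f x) p (Vilenkin.μ m) ≤
          ENNReal.ofReal (C * (n : ℝ) ^ (-α))) ∧
    (α + β = 1 →
      ∃ C : ℝ, ∀ᶠ n : ℕ in atTop,
        eLpNorm (fun x => Vilenkin.T m q f n x - f x) p (Vilenkin.μ m) ≤
          ENNReal.ofReal (C * ((n : ℝ) ^ (-(1 - β)) * Real.log n + (n : ℝ) ^ (-α)))) ∧
    (1 < α + β → β < 1 →
      ∃ C : ℝ, ∀ᶠ n : ℕ in atTop,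
        eLpNorm (fun x => Vilenkin.T m q f n x - f x) p (Vilenkin.μ m) ≤
          ENNReal.ofReal (C * (n : ℝ) ^ (-(1 - β)))) ∧
    (β = 1 →
      ∃ C : ℝ, ∀ᶠ n : ℕ in atTop,
        eLpNorm (fun x => Vilenkin.T m q f n x - f x) p (Vilenkin.μ m) ≤
          ENNReal.ofReal (C * (Real.log n)⁻¹)) := by
  have hQ := inv_sum_range_isBigO_rpow hq_nonneg hq_anti hq.2
  have key {σ s g : ℕ → ℝ} := hf.exists_eventually_eLpNorm_T_sub_le (σ := σ) (s := s) (g := g)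
    hm hbdd hq_nonneg hq_anti hq hp_one
  refine ⟨fun h => ?_, fun h => ?_, fun h _ => ?_, fun h => ?_⟩
  · refine key hQ (Vilenkin.sum_M_rpow_isBigO_rpow hm (by linarith)) (EventuallyEq.isBigO ?_)
      (Eventually.of_forall fun n => by positivity)
    filter_upwards [eventually_gt_atTop 0] with n hn
    rw [← Real.rpow_add (Nat.cast_pos.2 hn)]
    ring_nf
  · have hγ : 1 - α - β = 0 := by linarith
    refine key hQ (hγ ▸ Vilenkin.sum_M_rpow_zero_isBigO_log hm)
      (Asymptotics.isBigO_of_le _ fun n => ?_) (Eventually.of_forall fun n => by positivity)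
    rw [Real.norm_of_nonneg (by positivity), Real.norm_of_nonneg (by positivity)]
    exact le_add_of_nonneg_right (by positivity)
  · exact key hQ (Vilenkin.sum_M_rpow_isBigO_one hm (by linarith))
      (by simpa only [mul_one] using Asymptotics.isBigO_refl _ _)
      (Eventually.of_forall fun n => by positivity)
  · exact key (inv_sum_range_isBigO_inv_log hq_nonneg hq_anti (h ▸ hq.2))
      (Vilenkin.sum_M_rpow_isBigO_one hm (by linarith))
      (by simpa only [mul_one] using Asymptotics.isBigO_refl _ _)
      (Eventually.of_forall fun n => by positivity)

theorem corollary2 (m : ℕ → ℕ) [∀ k, NeZero (m k)] (hm : ∀ k, 2 ≤ m k)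
    (hbdd : BddAbove (Set.range m))
    (q : ℕ → ℝ) (hq_nonneg : ∀ k, 0 ≤ q k) (hq_anti : Antitone q)
    (β : ℝ) (hβ_pos : 0 < β) (hβ_le : β ≤ 1)
    (hq : q =Θ[atTop] fun k : ℕ => (k : ℝ) ^ (-β))
    (α : ℝ) (hα : 0 < α) (p : ℝ≥0∞) (hp_one : 1 ≤ p) (hp_top : p ≠ ∞)
    (f : Vilenkin.G m → ℂ) (hf : Vilenkin.Lip m α p f) :
    (α + β < 1 →
      ∃ C : ℝ, ∀ᶠ n : ℕ in atTop,
        eLpNorm (fun x => Vilenkin.T m q f n x - f x) p (Vilenkin.μ m) ≤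
          ENNReal.ofReal (C * (n : ℝ) ^ (-α))) ∧
    (α + β = 1 →
      ∃ C : ℝ, ∀ᶠ n : ℕ in atTop,
        eLpNorm (fun x => Vilenkin.T m q f n x - f x) p (Vilenkin.μ m) ≤
          ENNReal.ofReal (C * ((n : ℝ) ^ (-(1 - β)) * Real.log n + (n : ℝ) ^ (-α)))) ∧
    (1 < α + β → β < 1 →
      ∃ C : ℝ, ∀ᶠ n : ℕ in atTop,
        eLpNorm (fun x => Vilenkin.T m q f n x - f x) p (Vilenkin.μ m) ≤
          ENNReal.ofReal (C * (n : ℝ) ^ (-(1 - β)))) ∧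
    (β = 1 →
      ∃ C : ℝ, ∀ᶠ n : ℕ in atTop,
        eLpNorm (fun x => Vilenkin.T m q f n x - f x) p (Vilenkin.μ m) ≤
          ENNReal.ofReal (C * (Real.log n)⁻¹)) :=
  corollary2_general m hm hbdd q hq_nonneg hq_anti β hq α hα p hp_one f hf
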